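/- **Definitions.** For $x,y\in\mathbb R^2$ let $xy=\{x+t(y-x): 0<t<1\}$ denote the open segment. An (embedded) polygon $P$ is the closed curve $\bigcup_i \overline{v_iv_{i+1}}$ given by pairwise distinct points $v_1,\dots,v_n\in\mathbb R^2$ (indices cyclic) such that the open edges $v_iv_{i+1}$ are pairwise disjoint and contain no $v_j$, and no three consecutive points $v_i,v_{i+1},v_{i+2}$ are collinear. It need not be convex. Its vertex set is $V=\{v_1,\dots,v_n\}$, and its interior $\mathrm{int}(P)$ is the bounded connected component of $\mathbb R^2\setminus P$. For $y\in P\setminus V$, $T_yP$ denotes the line through $0$ parallel to the edge containing $y$. Let $P_-,P_+$ be two embedded polygons with vertex sets $V_-,V_+$ (they may overlap or coincide). Let $\mathcal P_{\max}$ be the set of $(x,y)\in(P_-\times P_+)\sqcup(P_+\times P_-)$, say $x\in P_\pm$ and $y\in P_\mp$, such that $y\notin V_\mp$ and there is exactly one $z\in P_\pm\cap\big(x+(T_yP_\mp\setminus\{0\})\big)$ with $xz\subset\mathrm{int}(P_\pm)$. The symplectic billiard map is $\phi:\mathcal P_{\max}\to(P_-\times P_+)\sqcup(P_+\times P_-)$,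 $\phi(x,y)=(y,z)$. Put $\sigma(x,y)=(y,x)$, $N_0=(P_-\times V_+)\sqcup(P_+\times V_-)$, $N_{i+1}=\phi^{-1}(N_i)$ and $N=\bigcup_{i\ge0}N_i\cup\sigma\big(\bigcup_{i\ge0}N_i\big)$. The phase space is $\mathcal P=\mathcal P_{\max}\setminus N$. A symplectic billiard orbit is a sequence $(p_k)_{k\in\mathbb Z}$ in $\mathcal P$ with $\phi(p_k)=p_{k+1}$ for all $k\in\mathbb Z$. Put $V_0^\pm=V_\pm$ and, for $i\ge1$, let $V_i^\pm$ be the set of all $v\in P_\pm$ for which there is $w\in V_{i-1}^\pm$ such that $vw\subset\mathrm{int}(P_\pm)$ and $vw$ is parallel to an edge of $P_\mp$. The filled set of vertices is $F=F_-\sqcup F_+$, where $F_\pm=\bigcup_{i\ge0}V_i^\pm$. **Theorem.** Let $(P_-,P_+)$ be a pair of embedded polygons, possibly non-convex, whose filled set of vertices $F$ is finite. Then for every $p\in\mathcal P$ there is exactly one symplectic billiard orbit $(p_k)_{k\in\mathbb Z}$ with $p_0=p$, and this orbit is periodic with (minimal) period at most $4\,|F_-|\,|F_+|$. -/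

import Mathlib

/-- The Euclidean plane. -/
abbrev Plane : Type := EuclideanSpace ℝ (Fin 2)

/-- An embedded polygon in the plane, possibly non-convex: a cyclic list of pairwise distinct
vertices whose open edges are pairwise disjoint and contain no vertex, and such that no three
consecutive vertices are collinear. The last condition forces at least three vertices. -/
structure EmbeddedPolygon where
  /-- The number of vertices. -/
  n : ℕ
  [neZero : NeZero n]
  /-- The underlying cyclic list of vertices. -/
  poly : Polygon Plane n
  injective_vertices : Function.Injective poly.vertices
  disjoint_edges : ∀ i j : Fin n, i ≠ j →
    Disjoint (openSegment ℝ (poly i) (poly (finRotate n i)))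
      (openSegment ℝ (poly j) (poly (finRotate n j)))
  vertex_notMem_edge : ∀ i j : Fin n,
    poly i ∉ openSegment ℝ (poly j) (poly (finRotate n j))
  nondegenerate : poly.HasNondegenerateVertices ℝ

attribute [instance] EmbeddedPolygon.neZero

namespace EmbeddedPolygon

/-- The polygon as a closed curve: the union of its closed edges. -/
def curve (Q : EmbeddedPolygon) : Set Plane := Q.poly.boundary ℝ

/-- The set of vertices. -/
def vertexSet (Q : EmbeddedPolygon) : Set Plane := Set.range Q.poly.vertices

/-- The `i`-th open edge. -/
def edge (Q : EmbeddedPolygon) (i : Fin Q.n) : Set Plane :=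
  openSegment ℝ (Q.poly i) (Q.poly (finRotate Q.n i))

/-- The vector from the start to the end of the `i`-th edge. -/
def edgeVec (Q : EmbeddedPolygon) (i : Fin Q.n) : Plane :=
  Q.poly (finRotate Q.n i) - Q.poly i

/-- The interior of the polygon: the points off the curve that lie in a bounded connected
component of the complement of the curve. -/
def inner (Q : EmbeddedPolygon) : Set Plane :=
  {x | x ∈ Q.curveᶜ ∧ Bornology.IsBounded (connectedComponentIn Q.curveᶜ x)}

/-- The tangent line (a linear line in the plane) of the polygon at a point `y` of an open edge.
At a vertex, and off the curve, this set is empty. -/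
def tangentLine (Q : EmbeddedPolygon) (y : Plane) : Set Plane :=
  {d | ∃ i : Fin Q.n, y ∈ Q.edge i ∧ d ∈ Submodule.span ℝ {Q.edgeVec i}}

end EmbeddedPolygon

/-- A pair of embedded polygons: `P false` is `P₋` and `P true` is `P₊`. The two polygons may
overlap or coincide. -/
abbrev PolygonPair : Type := Bool → EmbeddedPolygon

/-- An ordered pair of points of the plane together with a sign that says which polygon the first
point belongs to; the second point belongs to the other polygon. Thus
`(P₋ × P₊) ⊔ (P₊ × P₋)` is a set of such tagged pairs, see `PolygonPair.total`. -/
@[ext]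
structure TaggedPair where
  /-- The sign of the polygon of the first point. -/
  side : Bool
  /-- The first point. -/
  fst : Plane
  /-- The second point. -/
  snd : Plane

/-- The swap map `(x, y) ↦ (y, x)`, which interchanges the two parts of the disjoint union. -/
def TaggedPair.swap (p : TaggedPair) : TaggedPair := ⟨!p.side, p.snd, p.fst⟩

namespace PolygonPair

/-- The disjoint union `(P₋ × P₊) ⊔ (P₊ × P₋)`. -/
def total (P : PolygonPair) : Set TaggedPair :=
  {p | p.fst ∈ (P p.side).curve ∧ p.snd ∈ (P (!p.side)).curve}

/-- `z` is a point, other than `x`, of the intersection of the polygon of `x` with the line through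
`x` parallel to the tangent line at `y` of the other polygon, and the open segment from `x` to `z`
lies in the interior of the polygon of `x`. Here `p = (x, y)`. -/
def IsNextPoint (P : PolygonPair) (p : TaggedPair) (z : Plane) : Prop :=
  z ∈ (P p.side).curve ∧ z ≠ p.fst ∧ z - p.fst ∈ (P (!p.side)).tangentLine p.snd ∧
    openSegment ℝ p.fst z ⊆ (P p.side).inner

/-- The maximal phase space: the pairs `(x, y)` for which `y` is not a vertex and there is exactly
one point `z` that continues the trajectory. -/
def maxPhaseSpace (P : PolygonPair) : Set TaggedPair :=
  {p | p ∈ P.total ∧ p.snd ∉ (P (!p.side)).vertexSet ∧ ∃! z, P.IsNextPoint p z}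

/-- The symplectic billiard map `(x, y) ↦ (y, z)`, defined on the maximal phase space. -/
noncomputable def billiardMap (P : PolygonPair) (p : P.maxPhaseSpace) : TaggedPair :=
  ⟨!p.1.side, p.1.snd, p.2.2.2.choose⟩

/-- The sets `N₀ = (P₋ × V₊) ⊔ (P₊ × V₋)` and `N_{i+1} = φ⁻¹(N_i)`, where `φ` is the symplectic
billiard map on the maximal phase space. -/
def discontinuityStep (P : PolygonPair) : ℕ → Set TaggedPair
  | 0 => {p | p.fst ∈ (P p.side).curve ∧ p.snd ∈ (P (!p.side)).vertexSet}
  | i + 1 => Subtype.val '' (P.billiardMap ⁻¹' P.discontinuityStep i)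

/-- The discontinuity set `N = ⋃ N_i ∪ σ(⋃ N_i)`, where `σ` is the swap map. -/
def discontinuitySet (P : PolygonPair) : Set TaggedPair :=
  (⋃ i, P.discontinuityStep i) ∪ TaggedPair.swap '' (⋃ i, P.discontinuityStep i)

/-- The phase space: the maximal phase space without the discontinuity set. -/
def phaseSpace (P : PolygonPair) : Set TaggedPair := P.maxPhaseSpace \ P.discontinuitySet

/-- A symplectic billiard orbit: a bi-infinite sequence in the phase space in which each term is
mapped to the next one by the symplectic billiard map. -/
def IsOrbit (P : PolygonPair) (q : ℤ → P.phaseSpace) : Prop :=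
  ∀ k : ℤ, P.billiardMap ⟨(q k).1, (q k).2.1⟩ = (q (k + 1)).1

/-- The sets `V_i^±` of points that are reached from the vertices of `P s` by `i` moves, each along
an open segment that lies in the interior of `P s`, is parallel to an edge of the other polygon and
ends on `P s`. -/
def fillStep (P : PolygonPair) (s : Bool) : ℕ → Set Plane
  | 0 => (P s).vertexSet
  | i + 1 => {v | v ∈ (P s).curve ∧ ∃ w ∈ P.fillStep s i, openSegment ℝ v w ⊆ (P s).inner ∧
      ∃ j : Fin (P (!s)).n, w - v ∈ Submodule.span ℝ {(P (!s)).edgeVec j}}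

/-- The part `F_±` of the filled set of vertices on the polygon `P s`. -/
def filledPart (P : PolygonPair) (s : Bool) : Set Plane := ⋃ i, P.fillStep s i

/-- The filled set of vertices `F = F₋ ⊔ F₊`, as a disjoint union. -/
def filledSet (P : PolygonPair) : Set (Bool × Plane) := {f | f.2 ∈ P.filledPart f.1}

end PolygonPair

/-!
The proof has two parts: a Jordan curve theorem for polygons, which shows that the billiard map is
a reversible bijection of the phase space, and a count of cells, which gives periodicity.

*Sides of an edge.* The sum of the angles under which a point sees the edges (`windingAngle`) is
a multiple of `2π`, is locally constant off the curve and vanishes on the exterior, since it tends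
to `0` at infinity. It jumps by `2π` across an edge, so the two sides of an edge are not both
exterior. On the other hand, each point of the curve is a limit of exterior points: a punctured
neighbourhood of any point of the curve, vertices included, has only two sides, both of which touch
the whole curve nearby, so the set of limits of exterior points is open and closed in the connected
curve. Hence one side of each edge is interior and the other exterior (`exists_side`).

*Chords.* Consequently, from an interior point of an edge there is exactly one interior chord in
each direction other than that of the edge, and a chord never ends on an edge parallel to it.
Reversing chords shows that the swap map conjugates the billiard map to its inverse, so the phase
space is invariant and the orbit through a point exists and is unique (`existsUnique_orbit`).

*Cells.* Two points of an edge are in the same cell if they coincide or no filled vertex lies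
between them. If a point moves inside its cell, the end of its chord in a fixed edge direction of
the other polygon is never a filled vertex, hence never an ordinary vertex, so it stays on one edge
and in one cell (`exists_edge_of_isChord`). The cells of two consecutive points of an orbit
therefore determine all other cells, forwards and backwards. Marking a cell by its filled vertex or
by the last filled vertex before it, and using that membership in the filled set is preserved along
an orbit, the pigeonhole principle yields a period `2h ≤ 2 |F₋| |F₊|` of the sequence of cells.

*From cells to points.* Advancing time by `2h` acts on the line through each edge by an affine map:
a composition of parallel projections. Its orbits are bounded in both time directions, so the
increments of an orbit vanish or alternate in sign, and the points of the orbit have period `4h`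
(`periodic_of_parallel_moves`).
-/

open Set Filter Topology

/-! ### The cross product in the plane -/

/-- The cross product (signed area) of two plane vectors. -/
def planeCross (u v : Plane) : ℝ := u 0 * v 1 - u 1 * v 0

lemma Plane.ext {u v : Plane} (h0 : u 0 = v 0) (h1 : u 1 = v 1) : u = v := by
  ext i; fin_cases i <;> assumption

lemma planeCross_self (u : Plane) : planeCross u u = 0 := by simp [planeCross]; ring

lemma planeCross_swap (u v : Plane) : planeCross v u = -planeCross u v := by
  simp [planeCross]; ring

lemma planeCross_add_right (u v w : Plane) :
    planeCross u (v + w) = planeCross u v + planeCross u w := by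
  simp [planeCross]; ring

lemma planeCross_sub_right (u v w : Plane) :
    planeCross u (v - w) = planeCross u v - planeCross u w := by
  simp [planeCross]; ring

lemma planeCross_neg_right (u v : Plane) : planeCross u (-v) = -planeCross u v := by
  simp [planeCross]; ring

lemma planeCross_smul_right (c : ℝ) (u v : Plane) :
    planeCross u (c • v) = c * planeCross u v := by
  simp [planeCross]; ring

lemma planeCross_smul_left (c : ℝ) (u v : Plane) :
    planeCross (c • u) v = c * planeCross u v := by
  simp [planeCross]; ring

lemma planeCross_zero_right (u : Plane) : planeCross u 0 = 0 := by
  simp [planeCross]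

lemma continuous_planeCross (u w : Plane) : Continuous fun v : Plane => planeCross u (v - w) := by
  unfold planeCross
  simp only [PiLp.sub_apply]
  fun_prop

lemma planeCross_eq_zero_iff {u v : Plane} (hu : u ≠ 0) :
    planeCross u v = 0 ↔ ∃ c : ℝ, v = c • u := by
  constructor
  · intro h
    unfold planeCross at h
    by_cases h0 : u 0 = 0
    · have h1 : u 1 ≠ 0 := fun h1 => hu (Plane.ext (by simpa using h0) (by simpa using h1))
      refine ⟨v 1 / u 1, Plane.ext ?_ ?_⟩
      · have : v 0 = 0 := by
          rw [h0] at h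
          have : u 1 * v 0 = 0 := by linarith
          exact (mul_eq_zero.mp this).resolve_left h1
        simp [h0, this]
      · simp [h1]
    · refine ⟨v 0 / u 0, Plane.ext ?_ ?_⟩
      · simp [h0]
      · simp only [PiLp.smul_apply, smul_eq_mul]
        field_simp
        linarith
  · rintro ⟨c, rfl⟩
    rw [planeCross_smul_right, planeCross_self, mul_zero]

lemma planeCross_eq_zero_iff_mem_span {u v : Plane} (hu : u ≠ 0) :
    planeCross u v = 0 ↔ v ∈ Submodule.span ℝ {u} := by
  rw [planeCross_eq_zero_iff hu, Submodule.mem_span_singleton]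
  exact ⟨fun ⟨c, h⟩ => ⟨c, h.symm⟩, fun ⟨c, h⟩ => ⟨c, h.symm⟩⟩

/-- Cramer's rule in the plane. -/
lemma planeCross_smul_add_smul {b₁ b₂ : Plane} (h : planeCross b₁ b₂ ≠ 0) (p : Plane) :
    (planeCross p b₂ / planeCross b₁ b₂) • b₁ + (planeCross b₁ p / planeCross b₁ b₂) • b₂ = p := by
  rw [div_eq_inv_mul, div_eq_inv_mul, mul_smul, mul_smul, ← smul_add, inv_smul_eq_iff₀ h]
  apply Plane.ext <;> simp [planeCross] <;> ring

lemma mem_openSegment_iff_smul {a b x : Plane} :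
    x ∈ openSegment ℝ a b ↔ ∃ t : ℝ, 0 < t ∧ t < 1 ∧ x = a + t • (b - a) := by
  rw [openSegment_eq_image']
  constructor
  · rintro ⟨t, ⟨h0, h1⟩, rfl⟩; exact ⟨t, h0, h1, rfl⟩
  · rintro ⟨t, h0, h1, rfl⟩; exact ⟨t, ⟨h0, h1⟩, rfl⟩

lemma mem_segment_iff_smul {a b x : Plane} :
    x ∈ segment ℝ a b ↔ ∃ t : ℝ, 0 ≤ t ∧ t ≤ 1 ∧ x = a + t • (b - a) := by
  rw [segment_eq_image']
  constructor
  · rintro ⟨t, ⟨h0, h1⟩, rfl⟩; exact ⟨t, h0, h1, rfl⟩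
  · rintro ⟨t, h0, h1, rfl⟩; exact ⟨t, ⟨h0, h1⟩, rfl⟩

lemma mem_segment_iff_endpoints_or {a b x : Plane} :
    x ∈ segment ℝ a b ↔ x = a ∨ x = b ∨ x ∈ openSegment ℝ a b := by
  rw [← insert_endpoints_openSegment]; simp

lemma Plane.isCompact_segment (a b : Plane) : IsCompact (segment ℝ a b) := by
  rw [segment_eq_image']
  exact isCompact_Icc.image (by fun_prop)

/-! ### Edges and the local shape of the curve -/

namespace EmbeddedPolygon

variable (Q : EmbeddedPolygon)

lemma edgeVec_ne_zero (i : Fin Q.n) : Q.edgeVec i ≠ 0 := by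
  have := Q.nondegenerate.hasNondegenerateEdges i
  exact sub_ne_zero.mpr (Ne.symm this)

lemma planeCross_edgeVec_finRotate_ne_zero (i : Fin Q.n) :
    planeCross (Q.edgeVec i) (Q.edgeVec (finRotate Q.n i)) ≠ 0 := by
  intro h
  obtain ⟨c, hc⟩ := (planeCross_eq_zero_iff (Q.edgeVec_ne_zero i)).mp h
  have hnd := Q.nondegenerate i
  rw [affineIndependent_iff_not_collinear_set] at hnd
  apply hnd
  rw [collinear_iff_of_mem (p₀ := Q.poly i) (by simp)]
  have h2 : i + 2 = i + 1 + 1 := by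
    rw [add_assoc]
    congr 1
    ext
    simp [Fin.val_add, Fin.coe_ofNat_eq_mod]
  simp only [edgeVec, finRotate_apply] at hc
  refine ⟨Q.poly (i + 1) - Q.poly i, ?_⟩
  simp only [mem_insert_iff, mem_singleton_iff, forall_eq_or_imp, forall_eq, vadd_eq_add]
  refine ⟨⟨0, by simp⟩, ⟨1, by simp⟩, ⟨c + 1, ?_⟩⟩
  rw [add_smul, ← hc, one_smul, h2]
  abel

lemma mem_edge_iff {i : Fin Q.n} {x : Plane} :
    x ∈ Q.edge i ↔ ∃ t : ℝ, 0 < t ∧ t < 1 ∧ x = Q.poly i + t • Q.edgeVec i :=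
  mem_openSegment_iff_smul

lemma mem_curve_iff {x : Plane} :
    x ∈ Q.curve ↔ ∃ i, x ∈ segment ℝ (Q.poly i) (Q.poly (finRotate Q.n i)) := by
  simp [curve, Polygon.boundary, Polygon.edgeSet, affineSegment_eq_segment]

lemma curve_eq_iUnion :
    Q.curve = ⋃ i, segment ℝ (Q.poly i) (Q.poly (finRotate Q.n i)) := by
  ext x; simp [mem_curve_iff]

lemma vertexSet_subset_curve : Q.vertexSet ⊆ Q.curve := by
  rintro _ ⟨i, rfl⟩
  exact Q.mem_curve_iff.mpr ⟨i, left_mem_segment _ _ _⟩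

lemma edge_subset_curve (i : Fin Q.n) : Q.edge i ⊆ Q.curve := fun _ hx =>
  Q.mem_curve_iff.mpr ⟨i, openSegment_subset_segment _ _ _ hx⟩

lemma exists_mem_edge {x : Plane} (hx : x ∈ Q.curve) (hv : x ∉ Q.vertexSet) :
    ∃ i, x ∈ Q.edge i := by
  obtain ⟨i, hi⟩ := Q.mem_curve_iff.mp hx
  rcases mem_segment_iff_endpoints_or.mp hi with rfl | rfl | h
  · exact absurd ⟨_, rfl⟩ hv
  · exact absurd ⟨_, rfl⟩ hv
  · exact ⟨i, h⟩

lemma notMem_vertexSet_of_mem_edge {i : Fin Q.n} {x : Plane} (hx : x ∈ Q.edge i) :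
    x ∉ Q.vertexSet := by
  rintro ⟨j, rfl⟩
  exact Q.vertex_notMem_edge j i hx

lemma edge_unique {i j : Fin Q.n} {x : Plane} (hi : x ∈ Q.edge i) (hj : x ∈ Q.edge j) :
    i = j := by
  by_contra h
  exact Set.disjoint_left.mp (Q.disjoint_edges i j h) hi hj

lemma isCompact_curve : IsCompact Q.curve := by
  rw [curve_eq_iUnion]
  exact isCompact_iUnion fun i => Plane.isCompact_segment _ _

lemma isOpen_compl_curve : IsOpen Q.curveᶜ := Q.isCompact_curve.isClosed.isOpen_compl

/-- A point off finitely many closed edges has a neighbourhood off these edges. -/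
lemma eventually_notMem_segment (w : Plane) (I : Set (Fin Q.n))
    (hw : ∀ j ∈ I, w ∉ segment ℝ (Q.poly j) (Q.poly (finRotate Q.n j))) :
    ∀ᶠ v in 𝓝 w, ∀ j ∈ I, v ∉ segment ℝ (Q.poly j) (Q.poly (finRotate Q.n j)) := by
  rw [Filter.eventually_all]
  intro j
  by_cases hj : j ∈ I
  · filter_upwards [(Plane.isCompact_segment _ _).isClosed.isOpen_compl.mem_nhds (hw j hj)]
      with v hv _ using hv
  · exact Eventually.of_forall fun v h => absurd h hj

lemma notMem_segment_of_mem_edge {i j : Fin Q.n} {w : Plane} (hw : w ∈ Q.edge i) (hj : j ≠ i) :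
    w ∉ segment ℝ (Q.poly j) (Q.poly (finRotate Q.n j)) := by
  intro h
  rcases mem_segment_iff_endpoints_or.mp h with rfl | rfl | h
  · exact Q.vertex_notMem_edge _ _ hw
  · exact Q.vertex_notMem_edge _ _ hw
  · exact hj (Q.edge_unique h hw)

/-- Near an interior point of an edge, the curve is the line through that edge. -/
lemma eventually_mem_curve_iff_of_mem_edge {i : Fin Q.n} {w : Plane} (hw : w ∈ Q.edge i) :
    ∀ᶠ v in 𝓝 w, (v ∈ Q.curve ↔ planeCross (Q.edgeVec i) (v - w) = 0) ∧
      (planeCross (Q.edgeVec i) (v - w) = 0 → v ∈ Q.edge i) := by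
  obtain ⟨t, ht0, ht1, hwt⟩ := Q.mem_edge_iff.mp hw
  have he := Q.edgeVec_ne_zero i
  have hpos : 0 < min t (1 - t) * ‖Q.edgeVec i‖ :=
    mul_pos (lt_min ht0 (by linarith)) (norm_pos_iff.mpr he)
  filter_upwards [Q.eventually_notMem_segment w {j | j ≠ i}
    (fun j hj => Q.notMem_segment_of_mem_edge hw hj), Metric.ball_mem_nhds w hpos] with v hv hb
  have key : planeCross (Q.edgeVec i) (v - w) = 0 → v ∈ Q.edge i := by
    intro h
    obtain ⟨s, hs⟩ := (planeCross_eq_zero_iff he).mp h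
    rw [Metric.mem_ball, dist_eq_norm, hs, norm_smul, mul_lt_mul_iff_left₀ (norm_pos_iff.mpr he),
      Real.norm_eq_abs, lt_min_iff, abs_lt, abs_lt] at hb
    refine Q.mem_edge_iff.mpr ⟨t + s, by linarith [hb.1.1], by linarith [hb.2.2], ?_⟩
    rw [add_smul, ← hs, ← add_assoc, ← hwt]; abel
  refine ⟨⟨fun h => ?_, fun h => Q.edge_subset_curve i (key h)⟩, key⟩
  obtain ⟨j, hj⟩ := Q.mem_curve_iff.mp h
  have hji : j = i := by
    by_contra hne; exact hv j hne hj
  subst hji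
  obtain ⟨s, -, -, rfl⟩ := mem_segment_iff_smul.mp hj
  rw [hwt, add_sub_add_left_eq_sub, planeCross_sub_right]
  change planeCross _ (s • Q.edgeVec j) - _ = 0
  simp [planeCross_smul_right, planeCross_self]

/-- Near a vertex, the curve consists of two radii. -/
lemma exists_mem_curve_iff_of_vertex (i : Fin Q.n) :
    ∃ ε > 0, ∀ s t : ℝ, |s| < ε → |t| < ε →
      (Q.poly (finRotate Q.n i) + s • (-Q.edgeVec i) + t • Q.edgeVec (finRotate Q.n i) ∈ Q.curve ↔
        (0 ≤ s ∧ t = 0) ∨ (0 ≤ t ∧ s = 0)) := by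
  set k := finRotate Q.n i with hk
  set v := Q.poly k with hv
  have hI : ∀ j ∈ {j | j ≠ i ∧ j ≠ k}, v ∉ segment ℝ (Q.poly j) (Q.poly (finRotate Q.n j)) := by
    rintro j ⟨hji, hjk⟩ h
    rcases mem_segment_iff_endpoints_or.mp h with h | h | h
    · exact hjk (Q.injective_vertices h).symm
    · exact hji ((finRotate Q.n).injective (Q.injective_vertices h)).symm
    · exact Q.vertex_notMem_edge _ _ h
  have hcont : Continuous fun p : ℝ × ℝ => v + p.1 • (-Q.edgeVec i) + p.2 • Q.edgeVec k := by
    fun_prop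
  have hev := (hcont.tendsto (0, 0)).eventually
    (p := fun v' => ∀ j ∈ {j | j ≠ i ∧ j ≠ k},
      v' ∉ segment ℝ (Q.poly j) (Q.poly (finRotate Q.n j)))
    (by simpa only [zero_smul, add_zero] using Q.eventually_notMem_segment v _ hI)
  obtain ⟨ε, hε, hball⟩ := Metric.eventually_nhds_iff_ball.mp hev
  have hcr : planeCross (-Q.edgeVec i) (Q.edgeVec k) ≠ 0 := by
    have := Q.planeCross_edgeVec_finRotate_ne_zero i
    rw [← hk] at this
    rw [← neg_one_smul ℝ, planeCross_smul_left]
    simpa using this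
  -- the vectors along the two edges are independent, so the coordinates are unique
  have huniq : ∀ s t s' t' : ℝ, v + s • (-Q.edgeVec i) + t • Q.edgeVec k =
      v + s' • (-Q.edgeVec i) + t' • Q.edgeVec k → s = s' ∧ t = t' := by
    intro s t s' t' h
    have h' : (s - s') • (-Q.edgeVec i) + (t - t') • Q.edgeVec k = 0 := by
      have := sub_eq_zero.mpr h
      rw [← this]; module
    have h1 := congrArg (planeCross (-Q.edgeVec i)) h'
    have h2 := congrArg (planeCross (Q.edgeVec k)) h'
    rw [planeCross_add_right, planeCross_smul_right, planeCross_smul_right, planeCross_self,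
      planeCross_zero_right] at h1 h2
    rw [planeCross_swap] at h2
    constructor
    · have : (s - s') * planeCross (-Q.edgeVec i) (Q.edgeVec k) = 0 := by linarith
      linarith [(mul_eq_zero.mp this).resolve_right hcr]
    · have : (t - t') * planeCross (-Q.edgeVec i) (Q.edgeVec k) = 0 := by linarith
      linarith [(mul_eq_zero.mp this).resolve_right hcr]
  refine ⟨min ε 1, lt_min hε one_pos, fun s t hs ht => ⟨fun h => ?_, ?_⟩⟩
  · obtain ⟨j, hj⟩ := Q.mem_curve_iff.mp h
    have hnot := hball (s, t) (by
      rw [Metric.mem_ball, Prod.dist_eq]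
      simp only [Real.dist_eq, sub_zero]
      exact max_lt (hs.trans_le (min_le_left _ _)) (ht.trans_le (min_le_left _ _))) j
    have hjik : j = i ∨ j = k := by
      by_contra! hne
      exact hnot hne hj
    rcases hjik with rfl | hjk
    · obtain ⟨r, hr0, hr1, hr⟩ := mem_segment_iff_smul.mp hj
      have := huniq s t (1 - r) 0 (by
        rw [hr]
        simp only [edgeVec, ← hk, ← hv]; module)
      exact Or.inl ⟨by linarith [this.1], this.2⟩
    · rw [hjk] at hj
      obtain ⟨r, hr0, hr1, hr⟩ := mem_segment_iff_smul.mp hj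
      have := huniq s t 0 r (by
        rw [hr]
        simp only [edgeVec, ← hv]; module)
      exact Or.inr ⟨by linarith [this.2], this.1⟩
  · have hs1 := (abs_lt.mp (hs.trans_le (min_le_right _ _))).2
    have ht1 := (abs_lt.mp (ht.trans_le (min_le_right _ _))).2
    rintro (⟨h0, rfl⟩ | ⟨h0, rfl⟩)
    · refine Q.mem_curve_iff.mpr ⟨i, mem_segment_iff_smul.mpr ⟨1 - s, by linarith, by linarith, ?_⟩⟩
      simp only [edgeVec, ← hk, ← hv]; module
    · refine Q.mem_curve_iff.mpr ⟨k, mem_segment_iff_smul.mpr ⟨t, by linarith, by linarith, ?_⟩⟩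
      simp only [edgeVec, ← hk, ← hv]; module

lemma isPreconnected_curve : IsPreconnected Q.curve := by
  obtain ⟨m, hm⟩ : ∃ m, Q.n = m + 1 := Nat.exists_eq_succ_of_ne_zero (NeZero.ne Q.n)
  have hc : Q.curve = ⋃ k : ℕ, segment ℝ (Q.poly (Fin.ofNat Q.n k))
      (Q.poly (finRotate Q.n (Fin.ofNat Q.n k))) := by
    ext x
    rw [mem_curve_iff, mem_iUnion]
    exact ⟨fun ⟨i, hi⟩ => ⟨i, by simpa using hi⟩, fun ⟨k, hk⟩ => ⟨_, hk⟩⟩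
  rw [hc]
  refine IsPreconnected.iUnion_of_chain (fun k => (convex_segment _ _).isPreconnected) fun k => ?_
  refine ⟨Q.poly (finRotate Q.n (Fin.ofNat Q.n k)), right_mem_segment _ _ _, ?_⟩
  have : finRotate Q.n (Fin.ofNat Q.n k) = Fin.ofNat Q.n (Order.succ k) := by
    rw [finRotate_apply]
    ext
    simp [Fin.val_add, Order.succ_eq_add_one]
  rw [this]
  exact left_mem_segment _ _ _

end EmbeddedPolygon

/-! ### Half planes -/

/-- A nonzero vector is crossed positively by some vector. -/
lemma exists_planeCross_pos {e : Plane} (he : e ≠ 0) : ∃ m : Plane, 0 < planeCross e m := by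
  refine ⟨!₂[-e 1, e 0], ?_⟩
  have : planeCross e !₂[-e 1, e 0] = e 0 ^ 2 + e 1 ^ 2 := by simp [planeCross]; ring
  rw [this]
  by_contra! h
  exact he (Plane.ext (by simp; nlinarith [sq_nonneg (e 0), sq_nonneg (e 1)])
    (by simp; nlinarith [sq_nonneg (e 0), sq_nonneg (e 1)]))

/-- Each open half plane has its boundary line in its closure. -/
lemma mem_closure_halfPlane {e p w : Plane} (he : e ≠ 0) (h : planeCross e (p - w) = 0) {σ : ℝ}
    (hσ : σ ≠ 0) : p ∈ closure {v | 0 < σ * planeCross e (v - w)} := by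
  obtain ⟨m, hm⟩ := exists_planeCross_pos he
  have hc : Tendsto (fun t : ℝ => p + (t * σ) • m) (𝓝[>] 0) (𝓝 p) := by
    have : Continuous fun t : ℝ => p + (t * σ) • m := by fun_prop
    simpa using (this.tendsto 0).mono_left nhdsWithin_le_nhds
  refine mem_closure_of_tendsto hc ?_
  filter_upwards [self_mem_nhdsWithin] with t ht
  have ht : 0 < t := ht
  have h1 : planeCross e (p + (t * σ) • m - w) = t * σ * planeCross e m := by
    rw [add_sub_right_comm, planeCross_add_right, h, planeCross_smul_right, zero_add]
  change 0 < σ * planeCross e (p + (t * σ) • m - w)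
  rw [h1]
  have : 0 < σ * σ := mul_self_pos.mpr hσ
  calc (0 : ℝ) < t * (σ * σ) * planeCross e m := by positivity
    _ = _ := by ring

lemma convex_halfPlane (e w : Plane) (σ : ℝ) :
    Convex ℝ {v | 0 < σ * planeCross e (v - w)} := by
  intro x hx y hy a b ha hb hab
  have hx : 0 < σ * planeCross e (x - w) := hx
  have hy : 0 < σ * planeCross e (y - w) := hy
  change 0 < σ * planeCross e (a • x + b • y - w)
  have : a • x + b • y - w = a • (x - w) + b • (y - w) := by
    have h : w = (a + b) • w := by rw [hab, one_smul]
    nth_rewrite 1 [h]; module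
  rw [this, planeCross_add_right, planeCross_smul_right, planeCross_smul_right]
  rcases ha.eq_or_lt with rfl | ha
  · rw [zero_add] at hab; subst hab; simpa using hy
  · have := mul_pos ha hx
    have := mul_nonneg hb hy.le
    linarith

/-! ### The interior and the exterior -/

namespace EmbeddedPolygon

variable (Q : EmbeddedPolygon)

/-- The exterior of the polygon: the points off the curve that lie in an unbounded connected
component of the complement of the curve. -/
def outer : Set Plane := Q.curveᶜ \ Q.inner

lemma subset_inner_of_isPreconnected {S : Set Plane} (hS : IsPreconnected S)
    (hSc : S ⊆ Q.curveᶜ) {x : Plane} (hxS : x ∈ S) (hx : x ∈ Q.inner) : S ⊆ Q.inner := by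
  intro y hy
  refine ⟨hSc hy, ?_⟩
  rw [← connectedComponentIn_eq (hS.subset_connectedComponentIn hxS hSc hy)]
  exact hx.2

lemma subset_outer_of_isPreconnected {S : Set Plane} (hS : IsPreconnected S)
    (hSc : S ⊆ Q.curveᶜ) {x : Plane} (hxS : x ∈ S) (hx : x ∈ Q.outer) : S ⊆ Q.outer :=
  fun _ hy => ⟨hSc hy, fun h => hx.2 (Q.subset_inner_of_isPreconnected hS hSc hy h hxS)⟩

lemma isOpen_inner : IsOpen Q.inner := by
  rw [Metric.isOpen_iff]
  intro x hx
  obtain ⟨ε, hε, hb⟩ := Metric.isOpen_iff.mp Q.isOpen_compl_curve x hx.1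
  exact ⟨ε, hε, Q.subset_inner_of_isPreconnected (convex_ball _ _).isPreconnected hb
    (Metric.mem_ball_self hε) hx⟩

lemma isOpen_outer : IsOpen Q.outer := by
  rw [Metric.isOpen_iff]
  intro x hx
  obtain ⟨ε, hε, hb⟩ := Metric.isOpen_iff.mp Q.isOpen_compl_curve x hx.1
  exact ⟨ε, hε, Q.subset_outer_of_isPreconnected (convex_ball _ _).isPreconnected hb
    (Metric.mem_ball_self hε) hx⟩

lemma outer_nonempty : Q.outer.Nonempty := by
  obtain ⟨R, hR⟩ := Q.isCompact_curve.isBounded.subset_closedBall (0 : Plane)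
  obtain ⟨u, hu⟩ : ∃ u : Plane, ‖u‖ = 1 := ⟨EuclideanSpace.single 0 1, by simp⟩
  -- a ray that leaves the disc containing the curve
  set S : Set Plane := (fun t : ℝ => t • u) '' Ioi (max R 0) with hS
  have hSc : S ⊆ Q.curveᶜ := by
    rintro _ ⟨t, ht, rfl⟩ hmem
    have ht : max R 0 < t := ht
    have h := hR hmem
    have h0 : 0 < t := (le_max_right _ _).trans_lt ht
    simp only [mem_closedBall_zero_iff, norm_smul, hu, Real.norm_eq_abs, abs_of_pos h0] at h
    linarith [le_max_left R 0]
  have hSp : IsPreconnected S := isPreconnected_Ioi.image _ (by fun_prop)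
  have hx : (max R 0 + 1) • u ∈ S := ⟨_, by simp, rfl⟩
  refine ⟨(max R 0 + 1) • u, hSc hx, fun h => ?_⟩
  have hb := h.2.subset (hSp.subset_connectedComponentIn hx hSc)
  obtain ⟨M, hM⟩ := hb.subset_closedBall (0 : Plane)
  set t := max (max R 0) M + 1 with ht
  have h1 : max R 0 < t := by rw [ht]; linarith [le_max_left (max R 0) M]
  have h2 : M < t := by rw [ht]; linarith [le_max_right (max R 0) M]
  have h0 : 0 < t := (le_max_right _ _).trans_lt h1
  have h := hM ⟨t, h1, rfl⟩
  simp only [mem_closedBall_zero_iff, norm_smul, hu, Real.norm_eq_abs, abs_of_pos h0] at h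
  linarith

/-! ### Every point of the curve is a limit of exterior points -/

/-- A punctured neighbourhood of a point of the curve consists of two connected sides, each of which
has the nearby part of the curve in its closure. -/
def IsTwoSidedNhd (U S₁ S₂ : Set Plane) : Prop :=
  IsPreconnected S₁ ∧ IsPreconnected S₂ ∧ S₁ ⊆ Q.curveᶜ ∧ S₂ ⊆ Q.curveᶜ ∧
    U ∩ Q.curveᶜ ⊆ S₁ ∪ S₂ ∧ U ∩ Q.curve ⊆ closure S₁ ∧ U ∩ Q.curve ⊆ closure S₂

lemma exists_isTwoSidedNhd_of_mem_edge {i : Fin Q.n} {w : Plane} (hw : w ∈ Q.edge i) :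
    ∃ U ∈ 𝓝 w, ∃ S₁ S₂, Q.IsTwoSidedNhd U S₁ S₂ := by
  obtain ⟨ε, hε, hb⟩ := Metric.eventually_nhds_iff_ball.mp
    (Q.eventually_mem_curve_iff_of_mem_edge hw)
  have he := Q.edgeVec_ne_zero i
  have hside : ∀ σ : ℝ, σ ≠ 0 →
      IsPreconnected (Metric.ball w ε ∩ {v | 0 < σ * planeCross (Q.edgeVec i) (v - w)}) ∧
      Metric.ball w ε ∩ {v | 0 < σ * planeCross (Q.edgeVec i) (v - w)} ⊆ Q.curveᶜ ∧
      Metric.ball w ε ∩ Q.curve ⊆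
        closure (Metric.ball w ε ∩ {v | 0 < σ * planeCross (Q.edgeVec i) (v - w)}) := by
    refine fun σ hσ => ⟨((convex_ball _ _).inter (convex_halfPlane _ _ _)).isPreconnected, ?_, ?_⟩
    · rintro v ⟨hv, hpos⟩ hc
      have hpos : 0 < σ * planeCross (Q.edgeVec i) (v - w) := hpos
      rw [(hb v hv).1.mp hc, mul_zero] at hpos
      exact lt_irrefl _ hpos
    · rintro v ⟨hv, hc⟩
      exact Metric.isOpen_ball.inter_closure
        ⟨hv, mem_closure_halfPlane he ((hb v hv).1.mp hc) hσ⟩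
  obtain ⟨h1, h2, h3⟩ := hside 1 one_ne_zero
  obtain ⟨h1', h2', h3'⟩ := hside (-1) (by norm_num)
  refine ⟨_, Metric.ball_mem_nhds w hε, _, _, h1, h1', h2, h2', ?_, h3, h3'⟩
  rintro v ⟨hv, hc⟩
  have hne : planeCross (Q.edgeVec i) (v - w) ≠ 0 := fun h => hc ((hb v hv).1.mpr h)
  rcases lt_or_gt_of_ne hne with h | h
  · exact Or.inr ⟨hv, by simpa using h⟩
  · exact Or.inl ⟨hv, by simpa using h⟩

lemma exists_isTwoSidedNhd_of_vertex (i : Fin Q.n) :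
    ∃ U ∈ 𝓝 (Q.poly (finRotate Q.n i)), ∃ S₁ S₂, Q.IsTwoSidedNhd U S₁ S₂ := by
  obtain ⟨ε, hε, hb⟩ := Q.exists_mem_curve_iff_of_vertex i
  set v := Q.poly (finRotate Q.n i) with hv
  set b₁ := -Q.edgeVec i with hb₁
  set b₂ := Q.edgeVec (finRotate Q.n i) with hb₂
  have hcr : planeCross b₁ b₂ ≠ 0 := by
    rw [hb₁, ← neg_one_smul ℝ, planeCross_smul_left]
    exact mul_ne_zero (by norm_num) (Q.planeCross_edgeVec_finRotate_ne_zero i)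
  -- coordinates along the two edges at the vertex
  set g : ℝ × ℝ → Plane := fun p => v + p.1 • b₁ + p.2 • b₂ with hg
  have hgc : Continuous g := by fun_prop
  set f : Plane → ℝ × ℝ := fun p =>
    (planeCross (p - v) b₂ / planeCross b₁ b₂, planeCross b₁ (p - v) / planeCross b₁ b₂) with hf
  have hgf : ∀ p, g (f p) = p := fun p => by
    simp only [hg, hf]
    rw [add_assoc, planeCross_smul_add_smul hcr]; abel
  have hfc : Continuous f := by
    have h1 : Continuous fun p : Plane => planeCross (p - v) b₂ := by
      simp_rw [planeCross_swap b₂]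
      exact (continuous_planeCross _ _).neg
    exact (h1.div_const _).prodMk ((continuous_planeCross _ _).div_const _)
  have hf0 : f v = (0, 0) := by simp [hf, planeCross]
  set B : Set (ℝ × ℝ) := Ioo (-ε) ε ×ˢ Ioo (-ε) ε with hB
  have hU : f ⁻¹' B ∈ 𝓝 v := by
    refine hfc.continuousAt.preimage_mem_nhds ?_
    rw [hf0]
    exact prod_mem_nhds (Ioo_mem_nhds (by linarith) hε) (Ioo_mem_nhds (by linarith) hε)
  have hcurve : ∀ q ∈ B, (g q ∈ Q.curve ↔ (0 ≤ q.1 ∧ q.2 = 0) ∨ (0 ≤ q.2 ∧ q.1 = 0)) :=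
    fun q hq => hb q.1 q.2 (abs_lt.mpr hq.1) (abs_lt.mpr hq.2)
  set C₀ : Set (ℝ × ℝ) := Ioo 0 ε ×ˢ Ioo 0 ε with hC₀
  set C₁ : Set (ℝ × ℝ) := Ioo (-ε) ε ×ˢ Ioo (-ε) 0 with hC₁
  set C₂ : Set (ℝ × ℝ) := Ioo (-ε) 0 ×ˢ Ioo (-ε) ε with hC₂
  have hpre : ∀ a b c d : ℝ, IsPreconnected (Ioo a b ×ˢ Ioo c d) :=
    fun a b c d => isPreconnected_Ioo.prod isPreconnected_Ioo
  have hC₁₂ : IsPreconnected (C₁ ∪ C₂) := by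
    refine IsPreconnected.union (-ε / 2, -ε / 2) ?_ ?_ (hpre _ _ _ _) (hpre _ _ _ _)
    · exact ⟨⟨by simp; linarith, by simp; linarith⟩, ⟨by simp; linarith, by simp; linarith⟩⟩
    · exact ⟨⟨by simp; linarith, by simp; linarith⟩, ⟨by simp; linarith, by simp; linarith⟩⟩
  refine ⟨_, hU, g '' C₀, g '' (C₁ ∪ C₂), (hpre _ _ _ _).image _ hgc.continuousOn,
    hC₁₂.image _ hgc.continuousOn, ?_, ?_, ?_, ?_, ?_⟩
  · rintro _ ⟨q, ⟨⟨h1, h2⟩, ⟨h3, h4⟩⟩, rfl⟩ hc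
    rw [hcurve q ⟨⟨by linarith, h2⟩, ⟨by linarith, h4⟩⟩] at hc
    rcases hc with ⟨-, h⟩ | ⟨-, h⟩ <;> linarith
  · rintro _ ⟨q, ⟨⟨h1, h2⟩, ⟨h3, h4⟩⟩ | ⟨⟨h1, h2⟩, ⟨h3, h4⟩⟩, rfl⟩ hc
    · rw [hcurve q ⟨⟨h1, h2⟩, ⟨h3, by linarith⟩⟩] at hc
      rcases hc with ⟨-, h⟩ | ⟨h, -⟩ <;> linarith
    · rw [hcurve q ⟨⟨h1, by linarith⟩, ⟨h3, h4⟩⟩] at hc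
      rcases hc with ⟨h, -⟩ | ⟨-, h⟩ <;> linarith
  · rintro p ⟨hp, hpc⟩
    rw [← hgf p] at hpc ⊢
    set q := f p
    obtain ⟨⟨h1, h2⟩, ⟨h3, h4⟩⟩ := (hp : q ∈ B)
    have hn : ¬ ((0 ≤ q.1 ∧ q.2 = 0) ∨ (0 ≤ q.2 ∧ q.1 = 0)) := fun h =>
      hpc ((hcurve q ⟨⟨h1, h2⟩, ⟨h3, h4⟩⟩).mpr h)
    rcases lt_trichotomy q.2 0 with h | h | h
    · exact Or.inr ⟨q, Or.inl ⟨⟨h1, h2⟩, ⟨h3, h⟩⟩, rfl⟩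
    · have : q.1 < 0 := by
        by_contra! h'
        exact hn (Or.inl ⟨h', h⟩)
      exact Or.inr ⟨q, Or.inr ⟨⟨h1, this⟩, ⟨h3, h4⟩⟩, rfl⟩
    · rcases lt_trichotomy q.1 0 with h' | h' | h'
      · exact Or.inr ⟨q, Or.inr ⟨⟨h1, h'⟩, ⟨h3, h4⟩⟩, rfl⟩
      · exact absurd (Or.inr ⟨h.le, h'⟩) hn
      · exact Or.inl ⟨q, ⟨⟨h', h2⟩, ⟨h, h4⟩⟩, rfl⟩
  · rintro p ⟨hp, hpc⟩
    rw [← hgf p] at hpc ⊢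
    set q := f p
    refine image_closure_subset_closure_image hgc ⟨q, ?_, rfl⟩
    rw [hC₀, closure_prod_eq, closure_Ioo hε.ne]
    have hqB : q ∈ B := hp
    obtain ⟨⟨h1, h2⟩, ⟨h3, h4⟩⟩ := hqB
    rcases (hcurve q hp).mp hpc with ⟨h, h'⟩ | ⟨h, h'⟩
    · exact ⟨⟨h, h2.le⟩, ⟨h'.ge, h4.le⟩⟩
    · exact ⟨⟨h'.ge, h2.le⟩, ⟨h, h4.le⟩⟩
  · rintro p ⟨hp, hpc⟩
    rw [← hgf p] at hpc ⊢
    set q := f p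
    refine image_closure_subset_closure_image hgc ⟨q, ?_, rfl⟩
    rw [closure_union, hC₁, hC₂, closure_prod_eq, closure_prod_eq,
      closure_Ioo (neg_lt_self hε).ne,
      closure_Ioo (neg_lt_zero.mpr hε).ne]
    have hqB : q ∈ B := hp
    obtain ⟨⟨h1, h2⟩, ⟨h3, h4⟩⟩ := hqB
    rcases (hcurve q hp).mp hpc with ⟨h, h'⟩ | ⟨h, h'⟩
    · exact Or.inl ⟨⟨h1.le, h2.le⟩, ⟨h3.le, h'.le⟩⟩
    · exact Or.inr ⟨⟨h1.le, h'.le⟩, ⟨h3.le, h4.le⟩⟩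

lemma exists_isTwoSidedNhd {c : Plane} (hc : c ∈ Q.curve) :
    ∃ U ∈ 𝓝 c, ∃ S₁ S₂, Q.IsTwoSidedNhd U S₁ S₂ := by
  by_cases hv : c ∈ Q.vertexSet
  · obtain ⟨j, rfl⟩ := hv
    obtain ⟨i, rfl⟩ := (finRotate Q.n).surjective j
    exact Q.exists_isTwoSidedNhd_of_vertex i
  · obtain ⟨i, hi⟩ := Q.exists_mem_edge hc hv
    exact Q.exists_isTwoSidedNhd_of_mem_edge hi

/-- If a point of the curve is a limit of exterior points, then so are the nearby points of the
curve. -/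
lemma eventually_mem_closure_outer {c : Plane} (hc : c ∈ Q.curve) (hcl : c ∈ closure Q.outer) :
    ∀ᶠ v in 𝓝 c, v ∈ Q.curve → v ∈ closure Q.outer := by
  obtain ⟨U, hU, S₁, S₂, p₁, p₂, s₁, s₂, hUS, c₁, c₂⟩ := Q.exists_isTwoSidedNhd hc
  obtain ⟨x, hxU, hx⟩ := mem_closure_iff_nhds.mp hcl U hU
  filter_upwards [hU] with v hv hvc
  rcases hUS ⟨hxU, hx.1⟩ with h | h
  · exact closure_mono (Q.subset_outer_of_isPreconnected p₁ s₁ h hx) (c₁ ⟨hv, hvc⟩)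
  · exact closure_mono (Q.subset_outer_of_isPreconnected p₂ s₂ h hx) (c₂ ⟨hv, hvc⟩)

lemma curve_inter_closure_outer_nonempty : (Q.curve ∩ closure Q.outer).Nonempty := by
  by_contra hne
  rw [Set.not_nonempty_iff_eq_empty] at hne
  have hcl : IsClosed Q.outer := by
    refine isClosed_of_closure_subset fun x hx => ?_
    have hxc : x ∈ Q.curveᶜ := fun h => (hne ▸ ⟨h, hx⟩ : x ∈ (∅ : Set Plane))
    refine ⟨hxc, fun hi => ?_⟩
    obtain ⟨y, hy, hy'⟩ := mem_closure_iff.mp hx _ Q.isOpen_inner hi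
    exact hy'.2 hy
  have huniv := (IsClopen.eq_univ ⟨hcl, Q.isOpen_outer⟩ Q.outer_nonempty)
  have h0 : Q.poly 0 ∈ Q.curve := Q.vertexSet_subset_curve ⟨0, rfl⟩
  exact (huniv ▸ mem_univ (Q.poly 0) : Q.poly 0 ∈ Q.outer).1 h0

lemma curve_subset_closure_outer : Q.curve ⊆ closure Q.outer := by
  have h := isPreconnected_iff_subset_of_disjoint.mp Q.isPreconnected_curve
    (interior {v | v ∈ Q.curve → v ∈ closure Q.outer}) (closure Q.outer)ᶜ isOpen_interior
    isClosed_closure.isOpen_compl ?_ ?_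
  · rcases h with h | h
    · exact fun v hv => interior_subset (h hv) hv
    · obtain ⟨x, hx, hx'⟩ := Q.curve_inter_closure_outer_nonempty
      exact absurd hx' (h hx)
  · intro c hc
    by_cases hcl : c ∈ closure Q.outer
    · exact Or.inl (mem_interior_iff_mem_nhds.mpr (Q.eventually_mem_closure_outer hc hcl))
    · exact Or.inr hcl
  · rw [Set.eq_empty_iff_forall_notMem]
    rintro v ⟨hv, h1, h2⟩
    exact h2 (interior_subset h1 hv)

end EmbeddedPolygon

/-! ### The winding function and the two sides of an edge -/

/-- The identification of the plane with `ℂ`. -/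
noncomputable def planeToComplex : Plane ≃ₗᵢ[ℝ] ℂ := Complex.orthonormalBasisOneI.repr.symm

lemma planeToComplex_re (v : Plane) : (planeToComplex v).re = v 0 := by
  simp [planeToComplex]

lemma planeToComplex_im (v : Plane) : (planeToComplex v).im = v 1 := by
  simp [planeToComplex]

/-- The quotient of the vectors from `p` to `b` and to `a`, as complex numbers; its argument is the
angle under which `p` sees the segment from `a` to `b`. -/
noncomputable def viewRatio (a b p : Plane) : ℂ := planeToComplex (b - p) / planeToComplex (a - p)

lemma continuousAt_viewRatio {a b p : Plane} (h : p ≠ a) : ContinuousAt (viewRatio a b) p := by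
  have h1 : Continuous fun q : Plane => planeToComplex (b - q) :=
    planeToComplex.continuous.comp (by fun_prop)
  have h2 : Continuous fun q : Plane => planeToComplex (a - q) :=
    planeToComplex.continuous.comp (by fun_prop)
  refine h1.continuousAt.div h2.continuousAt ?_
  simpa [sub_eq_zero] using h.symm

lemma viewRatio_im (a b p : Plane) :
    (viewRatio a b p).im =
      planeCross (b - a) (p - a) / Complex.normSq (planeToComplex (a - p)) := by
  rw [viewRatio, Complex.div_im, planeToComplex_re, planeToComplex_im, planeToComplex_re,
    planeToComplex_im, ← sub_div]
  congr 1
  simp [planeCross]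
  ring

lemma viewRatio_mem_slitPlane {a b p : Plane} (h : p ∉ segment ℝ a b) :
    viewRatio a b p ∈ Complex.slitPlane := by
  by_contra hn
  rw [Complex.mem_slitPlane_iff, not_or, not_lt, not_not] at hn
  have hpa : planeToComplex (a - p) ≠ 0 := by
    intro h0
    have : a - p = 0 := planeToComplex.map_eq_zero_iff.mp h0
    exact h (by rw [← sub_eq_zero.mp this]; exact left_mem_segment _ _ _)
  set r := (viewRatio a b p).re with hr
  have h1 : viewRatio a b p = (r : ℂ) := Complex.ext (by simp [hr]) (by simp [hn.2])
  have h2 : planeToComplex (b - p) = planeToComplex (r • (a - p)) := by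
    rw [viewRatio, div_eq_iff hpa] at h1
    rw [h1, LinearIsometryEquiv.map_smul, Complex.real_smul]
  have h3 := planeToComplex.injective h2
  have hr1 : 0 < 1 - r := by linarith [hn.1]
  refine h (mem_segment_iff_smul.mpr ⟨1 / (1 - r), by positivity, ?_, ?_⟩)
  · rw [div_le_one hr1]; linarith [hn.1]
  · have h4 : b - a = (1 - r) • (p - a) := by
      have : b - a = (b - p) + (p - a) := by abel
      rw [this, h3]; module
    rw [h4, smul_smul, one_div_mul_cancel hr1.ne']
    simp

lemma tendsto_viewRatio_cobounded (a b : Plane) :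
    Tendsto (viewRatio a b) (Bornology.cobounded Plane) (𝓝 1) := by
  have h1 : Tendsto (fun p : Plane => planeToComplex (a - p)) (Bornology.cobounded Plane)
      (Bornology.cobounded ℂ) := by
    rw [← tendsto_norm_atTop_iff_cobounded]
    simp only [LinearIsometryEquiv.norm_map]
    have : Tendsto (fun p : Plane => ‖p‖ - ‖a‖) (Bornology.cobounded Plane) atTop :=
      tendsto_atTop_add_const_right _ _ tendsto_norm_cobounded_atTop
    refine tendsto_atTop_mono (fun p => ?_) this
    rw [norm_sub_rev]
    exact norm_sub_norm_le _ _
  have h2 : Tendsto (fun p : Plane => 1 + planeToComplex (b - a) * (planeToComplex (a - p))⁻¹)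
      (Bornology.cobounded Plane) (𝓝 (1 + planeToComplex (b - a) * 0)) :=
    ((tendsto_inv₀_cobounded.comp h1).const_mul _).const_add _
  rw [mul_zero, add_zero] at h2
  refine h2.congr' ?_
  filter_upwards [h1.eventually_ne_cobounded 0] with p hp
  have : b - p = (b - a) + (a - p) := by abel
  rw [viewRatio, this, map_add, add_div, div_self hp, add_comm, div_eq_mul_inv]

namespace EmbeddedPolygon

variable (Q : EmbeddedPolygon)

/-- The total angle (`2π` times the winding number) of the polygon as seen from `p`. -/
noncomputable def windingAngle (p : Plane) : ℝ :=
  ∑ i, Complex.arg (viewRatio (Q.poly i) (Q.poly (finRotate Q.n i)) p)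

lemma continuousAt_arg_viewRatio {a b p : Plane} (h : p ∉ segment ℝ a b) :
    ContinuousAt (fun q => Complex.arg (viewRatio a b q)) p :=
  ContinuousAt.comp (Complex.continuousAt_arg (viewRatio_mem_slitPlane h))
    (continuousAt_viewRatio fun h' => h (h' ▸ left_mem_segment _ _ _))

lemma notMem_segment_of_notMem_curve {p : Plane} (hp : p ∉ Q.curve) (i : Fin Q.n) :
    p ∉ segment ℝ (Q.poly i) (Q.poly (finRotate Q.n i)) :=
  fun h => hp (Q.mem_curve_iff.mpr ⟨i, h⟩)

lemma continuousOn_windingAngle : ContinuousOn Q.windingAngle Q.curveᶜ := fun _ hp =>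
  (tendsto_finsetSum _ fun i _ =>
    continuousAt_arg_viewRatio (Q.notMem_segment_of_notMem_curve hp i)).mono_left
      nhdsWithin_le_nhds

lemma exists_windingAngle_eq {p : Plane} (hp : p ∉ Q.curve) :
    ∃ k : ℤ, Q.windingAngle p = 2 * Real.pi * k := by
  suffices h : ((Q.windingAngle p : ℝ) : Real.Angle) = (0 : ℝ) by
    simpa using Real.Angle.angle_eq_iff_two_pi_dvd_sub.mp h
  have hne : ∀ i, planeToComplex (Q.poly i - p) ≠ 0 := by
    intro i h0
    have : Q.poly i - p = 0 := planeToComplex.map_eq_zero_iff.mp h0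
    exact hp (sub_eq_zero.mp this ▸ Q.vertexSet_subset_curve ⟨i, rfl⟩)
  have : ((Q.windingAngle p : ℝ) : Real.Angle) =
      ∑ i, ((Complex.arg (viewRatio (Q.poly i) (Q.poly (finRotate Q.n i)) p) : ℝ) :
        Real.Angle) := by
    rw [windingAngle]
    exact map_sum Real.Angle.coeHom _ _
  rw [this]
  simp_rw [viewRatio, fun i => Complex.arg_div_coe_angle (hne (finRotate Q.n i)) (hne i)]
  rw [Finset.sum_sub_distrib, Equiv.sum_comp (finRotate Q.n)
    (fun i => ((Complex.arg (planeToComplex (Q.poly i - p)) : ℝ) : Real.Angle)), sub_self]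
  simp

lemma windingAngle_eq_of_isPreconnected {S : Set Plane} (hS : IsPreconnected S)
    (hSc : S ⊆ Q.curveᶜ) {x y : Plane} (hx : x ∈ S) (hy : y ∈ S) :
    Q.windingAngle x = Q.windingAngle y := by
  have key : ∀ x ∈ S, ∀ y ∈ S, ¬ Q.windingAngle x < Q.windingAngle y := by
    intro x hx y hy hlt
    obtain ⟨k, hk⟩ := Q.exists_windingAngle_eq (hSc hx)
    obtain ⟨l, hl⟩ := Q.exists_windingAngle_eq (hSc hy)
    have hpi := Real.pi_pos
    have hkl : k < l := by
      rw [hk, hl] at hlt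
      exact_mod_cast lt_of_mul_lt_mul_left hlt (by positivity)
    have hkl' : (k : ℝ) + 1 ≤ l := by exact_mod_cast hkl
    -- an odd multiple of `π` lies between two different values
    have hmem : 2 * Real.pi * k + Real.pi ∈ Icc (Q.windingAngle x) (Q.windingAngle y) := by
      rw [hk, hl]
      constructor
      · linarith
      · nlinarith
    obtain ⟨z, hz, hz'⟩ := hS.intermediate_value hx hy (Q.continuousOn_windingAngle.mono hSc) hmem
    obtain ⟨m, hm⟩ := Q.exists_windingAngle_eq (hSc hz)
    have : Real.pi * (2 * k + 1) = Real.pi * (2 * m) := by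
      have := hm.symm.trans hz'
      linarith
    have : (2 * k + 1 : ℤ) = 2 * m := by exact_mod_cast mul_left_cancel₀ hpi.ne' this
    omega
  exact le_antisymm (not_lt.mp (key y hy x hx)) (not_lt.mp (key x hx y hy))

lemma eventually_windingAngle_eq_zero :
    ∀ᶠ p in Bornology.cobounded Plane, Q.windingAngle p = 0 := by
  have h : Tendsto Q.windingAngle (Bornology.cobounded Plane) (𝓝 0) := by
    have : Tendsto Q.windingAngle (Bornology.cobounded Plane)
        (𝓝 (∑ _i : Fin Q.n, Complex.arg 1)) :=
      tendsto_finsetSum _ fun i _ =>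
        (Complex.continuousAt_arg Complex.one_mem_slitPlane).tendsto.comp
          (tendsto_viewRatio_cobounded _ _)
    simpa using this
  have hpi := Real.pi_pos
  filter_upwards [h.eventually (Ioo_mem_nhds (by linarith : -(2 * Real.pi) < 0)
    (by linarith : 0 < 2 * Real.pi)),
    Bornology.isBounded_def.mp Q.isCompact_curve.isBounded] with p hp hpc
  obtain ⟨k, hk⟩ := Q.exists_windingAngle_eq hpc
  rw [hk] at hp ⊢
  have h1 : (k : ℝ) < 1 := by
    by_contra! h; nlinarith [hp.2]
  have h2 : (-1 : ℝ) < k := by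
    by_contra! h; nlinarith [hp.1]
  have h1' : k < 1 := by exact_mod_cast h1
  have h2' : -1 < k := by exact_mod_cast h2
  have : k = 0 := by omega
  simp [this]

lemma windingAngle_eq_zero_of_mem_outer {p : Plane} (hp : p ∈ Q.outer) :
    Q.windingAngle p = 0 := by
  set S := connectedComponentIn Q.curveᶜ p with hS
  have hub : ¬ Bornology.IsBounded S := fun h => hp.2 ⟨hp.1, h⟩
  obtain ⟨q, hqS, hq⟩ : ∃ q ∈ S, Q.windingAngle q = 0 := by
    by_contra! hne
    exact hub (Bornology.isBounded_def.mpr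
      (Q.eventually_windingAngle_eq_zero.mono fun q hq hqS => hne q hqS hq))
  rw [← hq]
  exact Q.windingAngle_eq_of_isPreconnected isPreconnected_connectedComponentIn
    (connectedComponentIn_subset _ _) (mem_connectedComponentIn hp.1) hqS

/-- The winding angle jumps by `2π` across an edge, so the two sides of an edge are not both
exterior. -/
lemma not_eventually_mem_outer {i : Fin Q.n} {w : Plane} (hw : w ∈ Q.edge i) :
    ¬ ∀ᶠ v in 𝓝 w, planeCross (Q.edgeVec i) (v - w) ≠ 0 → v ∈ Q.outer := by
  intro hout
  obtain ⟨t, ht0, ht1, hwt⟩ := Q.mem_edge_iff.mp hw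
  have he := Q.edgeVec_ne_zero i
  set a := Q.poly i with ha
  set b := Q.poly (finRotate Q.n i) with hb
  have hba : b - a = Q.edgeVec i := rfl
  have hwa : w ≠ a := by
    rw [hwt]; simpa using ⟨ht0.ne', he⟩
  have hva : ∀ v, planeCross (Q.edgeVec i) (v - a) = planeCross (Q.edgeVec i) (v - w) := by
    intro v
    have : v - a = (v - w) + t • Q.edgeVec i := by rw [hwt]; abel
    rw [this, planeCross_add_right, planeCross_smul_right, planeCross_self]; ring
  have him : (viewRatio a b w).im = 0 := by
    rw [viewRatio_im, hba, hva, sub_self, planeCross_zero_right, zero_div]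
  have hre : (viewRatio a b w).re < 0 := by
    have h1 : b - w = (-((1 - t) / t)) • (a - w) := by
      have hb' : b = a + Q.edgeVec i := by rw [← hba]; abel
      rw [hb', hwt, sub_add_cancel_left, smul_neg, neg_smul, neg_neg, smul_smul,
        div_mul_cancel₀ _ ht0.ne', sub_smul, one_smul]; abel
    have hne : planeToComplex (a - w) ≠ 0 := by simpa [sub_eq_zero] using hwa.symm
    have h2 : viewRatio a b w = ((-((1 - t) / t) : ℝ) : ℂ) := by
      rw [viewRatio, h1, LinearIsometryEquiv.map_smul, Complex.real_smul, mul_div_assoc,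
        div_self hne, mul_one]
    rw [h2, Complex.ofReal_re]
    have : 0 < (1 - t) / t := div_pos (by linarith) ht0
    linarith
  -- the contribution of the other edges is continuous at `w`
  set rest : Plane → ℝ := fun p => ∑ j ∈ Finset.univ.erase i,
    Complex.arg (viewRatio (Q.poly j) (Q.poly (finRotate Q.n j)) p) with hrest
  have hrc : Tendsto rest (𝓝 w) (𝓝 (rest w)) := tendsto_finsetSum _ fun j hj =>
    continuousAt_arg_viewRatio (Q.notMem_segment_of_mem_edge hw (Finset.ne_of_mem_erase hj))
  have hsum : ∀ p, Complex.arg (viewRatio a b p) + rest p = Q.windingAngle p := fun p =>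
    Finset.add_sum_erase _ (fun j => Complex.arg
      (viewRatio (Q.poly j) (Q.poly (finRotate Q.n j)) p)) (Finset.mem_univ i)
  have hside : ∀ σ : ℝ, σ ≠ 0 → ∀ θ : ℝ,
      Tendsto (fun p => Complex.arg (viewRatio a b p))
        (𝓝[{v | 0 < σ * planeCross (Q.edgeVec i) (v - w)}] w) (𝓝 θ) → θ + rest w = 0 := by
    intro σ hσ θ hθ
    have hne : (𝓝[{v | 0 < σ * planeCross (Q.edgeVec i) (v - w)}] w).NeBot :=
      mem_closure_iff_nhdsWithin_neBot.mp
        (mem_closure_halfPlane he (by rw [sub_self, planeCross_zero_right]) hσ)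
    refine tendsto_nhds_unique (hθ.add (hrc.mono_left nhdsWithin_le_nhds))
      (tendsto_const_nhds.congr' ?_)
    filter_upwards [self_mem_nhdsWithin, nhdsWithin_le_nhds hout] with v hv hvo
    have hv : 0 < σ * planeCross (Q.edgeVec i) (v - w) := hv
    rw [hsum, Q.windingAngle_eq_zero_of_mem_outer (hvo (right_ne_zero_of_mul hv.ne'))]
  have hnorm : ∀ v : Plane, 0 ≤ Complex.normSq (planeToComplex (a - v)) :=
    fun v => Complex.normSq_nonneg _
  have hcont := continuousAt_viewRatio (b := b) hwa
  have hp := hside 1 one_ne_zero Real.pi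
    ((Complex.tendsto_arg_nhdsWithin_im_nonneg_of_re_neg_of_im_zero hre him).comp
      (tendsto_nhdsWithin_iff.mpr ⟨hcont.tendsto.mono_left nhdsWithin_le_nhds, by
        filter_upwards [self_mem_nhdsWithin] with v hv
        have hv : 0 < 1 * planeCross (Q.edgeVec i) (v - w) := hv
        change 0 ≤ (viewRatio a b v).im
        rw [viewRatio_im, hba, hva]
        exact div_nonneg (by linarith) (hnorm v)⟩))
  have hn := hside (-1) (by norm_num) (-Real.pi)
    ((Complex.tendsto_arg_nhdsWithin_im_neg_of_re_neg_of_im_zero hre him).comp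
      (tendsto_nhdsWithin_iff.mpr ⟨hcont.tendsto.mono_left nhdsWithin_le_nhds, by
        filter_upwards [self_mem_nhdsWithin, nhdsWithin_le_nhds
          (isOpen_compl_singleton.mem_nhds hwa)] with v hv hva'
        have hv : 0 < -1 * planeCross (Q.edgeVec i) (v - w) := hv
        change (viewRatio a b v).im < 0
        rw [viewRatio_im, hba, hva]
        refine div_neg_of_neg_of_pos (by linarith) (Complex.normSq_pos.mpr ?_)
        have hva' : v ≠ a := hva'
        simpa [sub_eq_zero] using hva'.symm⟩))
  linarith [Real.pi_pos]

/-- The Jordan curve theorem near an interior point of an edge: one side of the edge belongs to the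
interior of the polygon, the other side to the exterior. -/
theorem exists_side {i : Fin Q.n} {w : Plane} (hw : w ∈ Q.edge i) :
    ∃ σ : ℝ, σ ≠ 0 ∧ ∀ᶠ v in 𝓝 w,
      (0 < σ * planeCross (Q.edgeVec i) (v - w) → v ∈ Q.inner) ∧
      (σ * planeCross (Q.edgeVec i) (v - w) < 0 → v ∈ Q.outer) ∧
      (planeCross (Q.edgeVec i) (v - w) = 0 → v ∈ Q.edge i) := by
  obtain ⟨ε, hε, hb⟩ := Metric.eventually_nhds_iff_ball.mp
    (Q.eventually_mem_curve_iff_of_mem_edge hw)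
  set H : ℝ → Set Plane := fun σ =>
    Metric.ball w ε ∩ {v | 0 < σ * planeCross (Q.edgeVec i) (v - w)} with hH
  have hHp : ∀ σ, IsPreconnected (H σ) := fun σ =>
    ((convex_ball _ _).inter (convex_halfPlane _ _ _)).isPreconnected
  have hHc : ∀ σ, H σ ⊆ Q.curveᶜ := by
    rintro σ v ⟨hv, hpos⟩ hc
    have hpos : 0 < σ * planeCross (Q.edgeVec i) (v - w) := hpos
    rw [(hb v hv).1.mp hc, mul_zero] at hpos
    exact lt_irrefl _ hpos
  have hdich : ∀ σ, H σ ⊆ Q.outer ∨ H σ ⊆ Q.inner := by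
    intro σ
    by_cases h : ∃ x ∈ H σ, x ∈ Q.outer
    · obtain ⟨x, hx, hxo⟩ := h
      exact Or.inl (Q.subset_outer_of_isPreconnected (hHp σ) (hHc σ) hx hxo)
    · push Not at h
      refine Or.inr fun x hx => ?_
      by_contra hxi
      exact h x hx ⟨hHc σ hx, hxi⟩
  have hballnhd := Metric.ball_mem_nhds w hε
  -- one side is exterior because `w` is a limit of exterior points
  obtain ⟨τ, hτ, hτo⟩ : ∃ τ : ℝ, (τ = 1 ∨ τ = -1) ∧ H τ ⊆ Q.outer := by
    obtain ⟨x, hxb, hxo⟩ := mem_closure_iff_nhds.mp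
      (Q.curve_subset_closure_outer (Q.edge_subset_curve i hw)) _ hballnhd
    have hne : planeCross (Q.edgeVec i) (x - w) ≠ 0 := fun h => hxo.1 ((hb x hxb).1.mpr h)
    rcases lt_or_gt_of_ne hne with h | h
    · have hx : x ∈ H (-1) := ⟨hxb, by simpa using h⟩
      exact ⟨-1, Or.inr rfl, Q.subset_outer_of_isPreconnected (hHp _) (hHc _) hx hxo⟩
    · have hx : x ∈ H 1 := ⟨hxb, by simpa using h⟩
      exact ⟨1, Or.inl rfl, Q.subset_outer_of_isPreconnected (hHp _) (hHc _) hx hxo⟩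
  have hτi : H (-τ) ⊆ Q.inner := by
    refine (hdich (-τ)).resolve_left fun hout => Q.not_eventually_mem_outer hw ?_
    filter_upwards [hballnhd] with v hv hne
    rcases lt_or_gt_of_ne (mul_ne_zero (by rcases hτ with rfl | rfl <;> norm_num : τ ≠ 0) hne)
      with h | h
    · exact hout ⟨hv, by simpa using h⟩
    · exact hτo ⟨hv, h⟩
  refine ⟨-τ, by rcases hτ with rfl | rfl <;> norm_num, ?_⟩
  filter_upwards [hballnhd] with v hv
  exact ⟨fun h => hτi ⟨hv, h⟩, fun h => hτo ⟨hv, by simpa using h⟩, (hb v hv).2⟩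

end EmbeddedPolygon

/-! ### Chords of a polygon -/

lemma eq_zero_of_planeCross_eq_zero {a b u : Plane} (hab : planeCross a b ≠ 0)
    (ha : planeCross a u = 0) (hb : planeCross b u = 0) : u = 0 := by
  have h := planeCross_smul_add_smul hab u
  rw [planeCross_swap, hb, ha] at h
  simpa using h.symm

namespace EmbeddedPolygon

variable (Q : EmbeddedPolygon)

/-- `z` is joined to `x` by a chord of the polygon that is parallel to `d` and runs in the
interior. -/
def IsChord (d x z : Plane) : Prop :=
  x ∈ Q.curve ∧ z ∈ Q.curve ∧ x ≠ z ∧ planeCross d (z - x) = 0 ∧ openSegment ℝ x z ⊆ Q.inner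

variable {Q}

lemma IsChord.symm {d x z : Plane} (h : Q.IsChord d x z) : Q.IsChord d z x := by
  refine ⟨h.2.1, h.1, h.2.2.1.symm, ?_, ?_⟩
  · rw [← neg_sub, planeCross_neg_right, h.2.2.2.1, neg_zero]
  · rw [openSegment_symm]; exact h.2.2.2.2

variable (Q)

lemma planeCross_sub_of_mem_edge {i : Fin Q.n} {v w : Plane} (hv : v ∈ Q.edge i)
    (hw : w ∈ Q.edge i) : planeCross (Q.edgeVec i) (v - w) = 0 := by
  obtain ⟨s, -, -, rfl⟩ := Q.mem_edge_iff.mp hv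
  obtain ⟨t, -, -, rfl⟩ := Q.mem_edge_iff.mp hw
  rw [add_sub_add_left_eq_sub, ← sub_smul, planeCross_smul_right, planeCross_self, mul_zero]

lemma convex_edge (i : Fin Q.n) : Convex ℝ (Q.edge i) := convex_openSegment _ _

lemma tendsto_add_smul (x u : Plane) : Tendsto (fun t : ℝ => x + t • u) (𝓝[>] 0) (𝓝 x) := by
  have : Continuous fun t : ℝ => x + t • u := by fun_prop
  simpa using (this.tendsto 0).mono_left nhdsWithin_le_nhds

/-- A chord that starts at an interior point of an edge leaves it into the interior side; in
particular it is not parallel to the edge. -/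
lemma pos_of_openSegment_subset_inner {i : Fin Q.n} {x z : Plane}
    (hz : openSegment ℝ x z ⊆ Q.inner) {σ : ℝ} (hσ : σ ≠ 0)
    (hside : ∀ᶠ v in 𝓝 x,
      (0 < σ * planeCross (Q.edgeVec i) (v - x) → v ∈ Q.inner) ∧
      (σ * planeCross (Q.edgeVec i) (v - x) < 0 → v ∈ Q.outer) ∧
      (planeCross (Q.edgeVec i) (v - x) = 0 → v ∈ Q.edge i)) :
    0 < σ * planeCross (Q.edgeVec i) (z - x) := by
  have hev := (tendsto_add_smul x (z - x)).eventually hside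
  have h1 : ∀ᶠ t : ℝ in 𝓝[>] 0, t < 1 := nhdsWithin_le_nhds (Iio_mem_nhds one_pos)
  obtain ⟨t, ht, ht1, ht0⟩ := (hev.and (h1.and self_mem_nhdsWithin)).exists
  have ht0 : 0 < t := ht0
  have hin := hz (mem_openSegment_iff_smul.mpr ⟨t, ht0, ht1, rfl⟩)
  rw [add_sub_cancel_left, planeCross_smul_right] at ht
  by_contra! hle
  rcases hle.lt_or_eq with h | h
  · exact (ht.2.1 (by nlinarith)).2 hin
  · have h0 : planeCross (Q.edgeVec i) (z - x) = 0 := (mul_eq_zero.mp h).resolve_left hσ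
    exact hin.1 (Q.edge_subset_curve i (ht.2.2 (by rw [h0, mul_zero])))

variable {Q}

lemma IsChord.exists_smul {d x z : Plane} (h : Q.IsChord d x z) (hd : d ≠ 0) :
    ∃ c : ℝ, z - x = c • d := (planeCross_eq_zero_iff hd).mp h.2.2.2.1

lemma IsChord.planeCross_ne_zero {d x z : Plane} (h : Q.IsChord d x z) (hd : d ≠ 0)
    {i : Fin Q.n} (hx : x ∈ Q.edge i) : planeCross (Q.edgeVec i) d ≠ 0 := by
  obtain ⟨σ, hσ, hs⟩ := Q.exists_side hx
  have hpos := Q.pos_of_openSegment_subset_inner h.2.2.2.2 hσ hs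
  obtain ⟨c, hc⟩ := h.exists_smul hd
  rw [hc, planeCross_smul_right] at hpos
  exact right_ne_zero_of_mul (right_ne_zero_of_mul hpos.ne')

lemma IsChord.unique {d x z z' : Plane} (h : Q.IsChord d x z) (h' : Q.IsChord d x z')
    (hd : d ≠ 0) {i : Fin Q.n} (hx : x ∈ Q.edge i) : z = z' := by
  obtain ⟨σ, hσ, hs⟩ := Q.exists_side hx
  have hpos := Q.pos_of_openSegment_subset_inner h.2.2.2.2 hσ hs
  have hpos' := Q.pos_of_openSegment_subset_inner h'.2.2.2.2 hσ hs
  obtain ⟨c, hc⟩ := h.exists_smul hd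
  obtain ⟨c', hc'⟩ := h'.exists_smul hd
  rw [hc, planeCross_smul_right] at hpos
  rw [hc', planeCross_smul_right] at hpos'
  have hcc : 0 < c / c' := by
    have : c / c' = (σ * (c * planeCross (Q.edgeVec i) d)) /
        (σ * (c' * planeCross (Q.edgeVec i) d)) := by
      have := right_ne_zero_of_mul (right_ne_zero_of_mul hpos.ne')
      field_simp
    rw [this]; exact div_pos hpos hpos'
  have hc0 : c ≠ 0 := left_ne_zero_of_mul (right_ne_zero_of_mul hpos.ne')
  have hc0' : c' ≠ 0 := left_ne_zero_of_mul (right_ne_zero_of_mul hpos'.ne')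
  -- the shorter of two chords on the same ray would end in the interior
  rcases lt_trichotomy (c / c') 1 with h1 | h1 | h1
  · have : z ∈ openSegment ℝ x z' := mem_openSegment_iff_smul.mpr ⟨c / c', hcc, h1, by
      rw [hc', smul_smul, div_mul_cancel₀ _ hc0', ← hc]; abel⟩
    exact absurd h.2.1 (h'.2.2.2.2 this).1
  · rw [div_eq_one_iff_eq hc0'] at h1
    rw [h1, ← hc'] at hc
    simpa using hc
  · have : z' ∈ openSegment ℝ x z := mem_openSegment_iff_smul.mpr ⟨c' / c, by
      rw [← inv_div]; exact inv_pos.mpr hcc, by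
      rw [← inv_div]; exact inv_lt_one_of_one_lt₀ h1, by
      rw [hc, smul_smul, div_mul_cancel₀ _ hc0, ← hc']; abel⟩
    exact absurd h'.2.1 (h.2.2.2.2 this).1

variable (Q)

/-- A ray that starts into the interior runs in the interior until it meets the curve. -/
lemma exists_first_hit {x u : Plane} (hu : u ≠ 0)
    (h : ∀ᶠ t : ℝ in 𝓝[>] 0, x + t • u ∈ Q.inner) :
    ∃ t : ℝ, 0 < t ∧ x + t • u ∈ Q.curve ∧ openSegment ℝ x (x + t • u) ⊆ Q.inner := by
  obtain ⟨δ, hδ, hin⟩ := mem_nhdsGT_iff_exists_Ioo_subset.mp h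
  have hδ : 0 < δ := hδ
  set t₀ := δ / 2 with ht₀
  have ht₀pos : 0 < t₀ := by positivity
  have hin₀ : ∀ t, 0 < t → t ≤ t₀ → x + t • u ∈ Q.inner := fun t h0 h1 =>
    hin ⟨h0, by linarith⟩
  have hc : Continuous fun t : ℝ => x + t • u := by fun_prop
  set T : Set ℝ := {t | t₀ ≤ t ∧ x + t • u ∈ Q.curve} with hT
  have hTc : IsClosed T :=
    isClosed_Ici.inter (Q.isCompact_curve.isClosed.preimage hc)
  have hTne : T.Nonempty := by
    by_contra hne
    rw [Set.not_nonempty_iff_eq_empty] at hne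
    set S : Set Plane := (fun t : ℝ => x + t • u) '' Ici t₀
    have hSc : S ⊆ Q.curveᶜ := by
      rintro _ ⟨t, ht, rfl⟩ hmem
      exact (hne ▸ ⟨ht, hmem⟩ : t ∈ (∅ : Set ℝ))
    have hSp : IsPreconnected S := isPreconnected_Ici.image _ hc.continuousOn
    have hxS : x + t₀ • u ∈ S := ⟨t₀, self_mem_Ici, rfl⟩
    have hb := (hin₀ t₀ ht₀pos le_rfl).2.subset (hSp.subset_connectedComponentIn hxS hSc)
    obtain ⟨M, hM⟩ := hb.subset_closedBall x
    have hun := norm_pos_iff.mpr hu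
    set t := max t₀ ((M + 1) / ‖u‖)
    have h1 := hM ⟨t, mem_Ici.mpr (le_max_left _ _), rfl⟩
    have ht0 : 0 < t := ht₀pos.trans_le (le_max_left _ _)
    rw [mem_closedBall_iff_norm, add_sub_cancel_left, norm_smul, Real.norm_eq_abs,
      abs_of_pos ht0] at h1
    have h2 : (M + 1) / ‖u‖ ≤ t := le_max_right _ _
    rw [div_le_iff₀ hun] at h2
    linarith
  have hTb : BddBelow T := ⟨t₀, fun t ht => ht.1⟩
  have hmem := hTc.csInf_mem hTne hTb
  set t₁ := sInf T
  have hlt : t₀ < t₁ := lt_of_le_of_ne hmem.1 fun h =>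
    (hin₀ t₀ ht₀pos le_rfl).1 (h ▸ hmem.2)
  have ht₁pos : 0 < t₁ := ht₀pos.trans hlt
  refine ⟨t₁, ht₁pos, hmem.2, ?_⟩
  have hseg : openSegment ℝ x (x + t₁ • u) ⊆ (fun t : ℝ => x + t • u) '' Ioo 0 t₁ := by
    intro v hv
    obtain ⟨s, hs0, hs1, rfl⟩ := mem_openSegment_iff_smul.mp hv
    refine ⟨s * t₁, ⟨mul_pos hs0 ht₁pos, by nlinarith⟩, ?_⟩
    simp only [add_sub_cancel_left, smul_smul]
  refine hseg.trans (Q.subset_inner_of_isPreconnected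
    (isPreconnected_Ioo.image _ hc.continuousOn) ?_ ⟨t₀, ⟨ht₀pos, hlt⟩, rfl⟩
    (hin₀ t₀ ht₀pos le_rfl))
  rintro _ ⟨t, ⟨h0, h1⟩, rfl⟩ hmem'
  rcases le_or_gt t t₀ with h2 | h2
  · exact (hin₀ t h0 h2).1 hmem'
  · exact (csInf_le hTb ⟨h2.le, hmem'⟩).not_gt h1

/-- From an interior point of an edge, there is a chord in every direction other than that of the
edge. -/
lemma exists_isChord {i : Fin Q.n} {x d : Plane} (hx : x ∈ Q.edge i)
    (hd : planeCross (Q.edgeVec i) d ≠ 0) : ∃ z, Q.IsChord d x z := by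
  obtain ⟨σ, hσ, hs⟩ := Q.exists_side hx
  set κ := σ * planeCross (Q.edgeVec i) d with hκ
  have hκ0 : κ ≠ 0 := mul_ne_zero hσ hd
  have hd0 : d ≠ 0 := by
    rintro rfl; exact hd (planeCross_zero_right _)
  -- the multiple of `d` that points into the interior
  have hu : κ • d ≠ 0 := smul_ne_zero hκ0 hd0
  obtain ⟨t, ht, hc, hin⟩ := Q.exists_first_hit (x := x) hu (by
    filter_upwards [(tendsto_add_smul x (κ • d)).eventually hs, self_mem_nhdsWithin] with t ht ht0
    have ht0 : 0 < t := ht0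
    refine ht.1 ?_
    rw [add_sub_cancel_left, planeCross_smul_right, planeCross_smul_right]
    have : 0 < κ * κ := mul_self_pos.mpr hκ0
    calc 0 < t * (κ * κ) := by positivity
      _ = σ * (t * (κ * planeCross (Q.edgeVec i) d)) := by rw [hκ]; ring)
  refine ⟨_, Q.edge_subset_curve i hx, hc, ?_, ?_, hin⟩
  · simpa using ⟨ht.ne', hκ0, hd0⟩
  · rw [add_sub_cancel_left, planeCross_smul_right, planeCross_smul_right, planeCross_self]; ring

/-- A chord that ends in an interior point of an edge can be moved in parallel to nearby points. -/
lemma eventually_isChord {i k : Fin Q.n} {d x z : Plane} (hx : x ∈ Q.edge i) (hz : z ∈ Q.edge k)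
    (hd : d ≠ 0) (h : Q.IsChord d x z) :
    ∀ᶠ w in 𝓝 x, w ∈ Q.edge i → ∃ z' ∈ Q.edge k, Q.IsChord d w z' := by
  have hkd : planeCross (Q.edgeVec k) d ≠ 0 := h.symm.planeCross_ne_zero hd hz
  obtain ⟨σ, hσ, hs⟩ := Q.exists_side hx
  obtain ⟨τ, hτ, ht⟩ := Q.exists_side hz
  have hpos := Q.pos_of_openSegment_subset_inner h.2.2.2.2 hσ hs
  have hpos' := Q.pos_of_openSegment_subset_inner h.symm.2.2.2.2 hτ ht
  -- the projection along `d` onto the line through the edge of `z`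
  set l : Plane → ℝ := fun w => -planeCross (Q.edgeVec k) (w - z) / planeCross (Q.edgeVec k) d
    with hl
  have hlc : Continuous l := (continuous_planeCross _ _).neg.div_const _
  set g : Plane → Plane := fun w => w + l w • d with hg
  have hgc : Continuous g := by fun_prop
  have hgx : g x = z := by
    obtain ⟨c, hc⟩ := h.exists_smul hd
    have : l x = c := by
      rw [hl]
      simp only
      rw [← planeCross_neg_right, neg_sub, hc, planeCross_smul_right, mul_div_cancel_right₀ _ hkd]
    rw [hg]
    simp only
    rw [this, ← hc]; abel
  have hgt : Tendsto g (𝓝 x) (𝓝 z) := by simpa only [hgx] using hgc.tendsto x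
  have hgk : ∀ w, planeCross (Q.edgeVec k) (g w - z) = 0 := by
    intro w
    have : g w - z = (w - z) + l w • d := by simp only [hg]; abel
    rw [this, planeCross_add_right, planeCross_smul_right, hl]
    simp only
    rw [div_mul_cancel₀ _ hkd, add_neg_cancel]
  have hgd : ∀ w, planeCross d (g w - w) = 0 := by
    intro w
    rw [hg]; simp only
    rw [add_sub_cancel_left, planeCross_smul_right, planeCross_self, mul_zero]
  set m : Plane × ℝ → Plane := fun q => q.1 + q.2 • (g q.1 - q.1) with hm
  have hmc : Continuous m := by fun_prop
  have htube : ∀ᶠ w in 𝓝 x, ∀ t ∈ Icc (0 : ℝ) 1, w ∈ Q.edge i → 0 < t → t < 1 →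
      w + t • (g w - w) ∈ Q.inner := by
    refine isCompact_Icc.eventually_forall_of_forall_eventually fun t htI => ?_
    rcases htI.1.eq_or_lt with rfl | ht0
    · have hm0 : Tendsto m (𝓝 (x, 0)) (𝓝 x) := by simpa [hm] using hmc.tendsto (x, 0)
      have e1 := hm0.eventually hs
      have e2 : ∀ᶠ q : Plane × ℝ in 𝓝 (x, 0),
          0 < σ * planeCross (Q.edgeVec i) (g q.1 - q.1) := by
        have hc : Continuous fun q : Plane × ℝ => σ * planeCross (Q.edgeVec i) (g q.1 - q.1) := by
          unfold planeCross
          simp only [PiLp.sub_apply]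
          fun_prop
        refine (hc.tendsto (x, 0)).eventually (lt_mem_nhds ?_)
        simpa only [hgx] using hpos
      filter_upwards [e1, e2] with q h1 h2 hqi hq0 _
      refine h1.1 ?_
      have : m q - x = (q.1 - x) + q.2 • (g q.1 - q.1) := by simp only [hm]; abel
      rw [this, planeCross_add_right, planeCross_smul_right, Q.planeCross_sub_of_mem_edge hqi hx]
      calc 0 < q.2 * (σ * planeCross (Q.edgeVec i) (g q.1 - q.1)) := by positivity
        _ = _ := by ring
    · rcases htI.2.eq_or_lt with rfl | ht1
      · have hm1 : Tendsto m (𝓝 (x, 1)) (𝓝 z) := by simpa [hm, hgx] using hmc.tendsto (x, 1)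
        have e1 := hm1.eventually ht
        have e2 : ∀ᶠ q : Plane × ℝ in 𝓝 (x, 1),
            0 < τ * planeCross (Q.edgeVec k) (q.1 - g q.1) := by
          have hc : Continuous fun q : Plane × ℝ =>
              τ * planeCross (Q.edgeVec k) (q.1 - g q.1) := by
            unfold planeCross
            simp only [PiLp.sub_apply]
            fun_prop
          refine (hc.tendsto (x, 1)).eventually (lt_mem_nhds ?_)
          simpa only [hgx] using hpos'
        filter_upwards [e1, e2] with q h1 h2 hqi _ hq1
        refine h1.1 ?_
        have : m q - z = (g q.1 - z) + (1 - q.2) • (q.1 - g q.1) := by simp only [hm]; module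
        rw [this, planeCross_add_right, planeCross_smul_right, hgk]
        have : 0 < 1 - q.2 := by linarith
        calc 0 < (1 - q.2) * (τ * planeCross (Q.edgeVec k) (q.1 - g q.1)) := by positivity
          _ = _ := by ring
      · have hin : m (x, t) ∈ Q.inner := by
          refine h.2.2.2.2 (mem_openSegment_iff_smul.mpr ⟨t, ht0, ht1, ?_⟩)
          simp [hm, hgx]
        filter_upwards [(hmc.tendsto (x, t)).eventually (Q.isOpen_inner.mem_nhds hin)]
          with q hq _ _ _ using hq
  have hne : ∀ᶠ w in 𝓝 x, w ≠ g w := by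
    have : Continuous fun w => w - g w := by fun_prop
    filter_upwards [(this.tendsto x).eventually_ne
      (by rw [hgx, sub_ne_zero]; exact h.2.2.1 : x - g x ≠ 0)] with w hw
    exact sub_ne_zero.mp hw
  filter_upwards [htube, hne, hgt.eventually ht] with w h1 h2 h3 hw
  have hgw : g w ∈ Q.edge k := h3.2.2 (hgk w)
  refine ⟨g w, hgw, Q.edge_subset_curve i hw, Q.edge_subset_curve k hgw, h2, hgd w, ?_⟩
  intro v hv
  obtain ⟨t, ht0, ht1, rfl⟩ := mem_openSegment_iff_smul.mp hv
  exact h1 t ⟨ht0.le, ht1.le⟩ hw ht0 ht1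

/-- Parallel chords that start on a piece of an edge without points of `F` end on a piece of an
edge without points of `F`, if `F` contains the vertices and with each point the other ends of
its chords. -/
lemma exists_edge_of_isChord {F : Set Plane} (hVF : Q.vertexSet ⊆ F) {d : Plane} (hd : d ≠ 0)
    (hF : ∀ v w, Q.IsChord d v w → w ∈ F → v ∈ F) {i : Fin Q.n} {x x' z z' : Plane}
    (hx : x ∈ Q.edge i) (hx' : x' ∈ Q.edge i) (hxx' : Disjoint (segment ℝ x x') F)
    (h : Q.IsChord d x z) (h' : Q.IsChord d x' z') :
    ∃ k, z ∈ Q.edge k ∧ z' ∈ Q.edge k ∧ Disjoint (segment ℝ z z') F := by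
  have hid := h.planeCross_ne_zero hd hx
  have hseg : segment ℝ x x' ⊆ Q.edge i := (Q.convex_edge i).segment_subset hx hx'
  have hex : ∀ w : segment ℝ x x', ∃ z, Q.IsChord d w z :=
    fun w => Q.exists_isChord (hseg w.2) hid
  choose f hf using hex
  have hfF : ∀ w, f w ∉ F := fun w hw => Set.disjoint_left.mp hxx' w.2 (hF _ _ (hf w) hw)
  choose κ hκ using fun w => Q.exists_mem_edge (hf w).2.1 fun hv => hfF w (hVF hv)
  have hloc : Continuous κ := by
    rw [continuous_iff_continuousAt]
    intro w
    have hev := Q.eventually_isChord (hseg w.2) (hκ w) hd (hf w)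
    refine (continuousAt_const (y := κ w)).congr ?_
    filter_upwards [continuous_subtype_val.continuousAt.eventually hev] with w' hw'
    obtain ⟨y, hy, hy'⟩ := hw' (hseg w'.2)
    rw [hy'.unique (hf w') hd (hseg w'.2)] at hy
    exact Q.edge_unique hy (hκ w')
  have : PreconnectedSpace (segment ℝ x x') :=
    Subtype.preconnectedSpace (convex_segment x x').isPreconnected
  have hconst : ∀ w w', κ w = κ w' := fun w w' =>
    isPreconnected_univ.constant hloc.continuousOn (mem_univ w) (mem_univ w')
  have hfz : f ⟨x, left_mem_segment _ _ _⟩ = z := (hf _).unique h hd hx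
  have hfz' : f ⟨x', right_mem_segment _ _ _⟩ = z' := (hf _).unique h' hd hx'
  set k := κ ⟨x, left_mem_segment _ _ _⟩ with hk
  have hκk : ∀ w, f w ∈ Q.edge k := fun w => by
    rw [hk, ← hconst w]; exact hκ w
  have hz : z ∈ Q.edge k := hfz ▸ hκk _
  have hz' : z' ∈ Q.edge k := hfz' ▸ hκk _
  refine ⟨k, hz, hz', Set.disjoint_left.mpr fun v hv hvF => ?_⟩
  -- every point between `z` and `z'` is the end of a chord that starts between `x` and `x'`
  obtain ⟨t, ht0, ht1, hvt⟩ := mem_segment_iff_smul.mp hv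
  have hw : x + t • (x' - x) ∈ segment ℝ x x' := mem_segment_iff_smul.mpr ⟨t, ht0, ht1, rfl⟩
  have hvk : v ∈ Q.edge k := (Q.convex_edge k).segment_subset hz hz' hv
  have hkd : planeCross (Q.edgeVec k) d ≠ 0 := h.symm.planeCross_ne_zero hd hz
  have h1 := Q.planeCross_sub_of_mem_edge hvk (hκk ⟨_, hw⟩)
  have h2 : planeCross d (v - f ⟨_, hw⟩) = 0 := by
    have : v - f ⟨_, hw⟩ = (1 - t) • (z - x) + t • (z' - x') - (f ⟨_, hw⟩ - (x + t • (x' - x))) := by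
      rw [hvt]; module
    rw [this, planeCross_sub_right, planeCross_add_right, planeCross_smul_right,
      planeCross_smul_right, h.2.2.2.1, h'.2.2.2.1, (hf ⟨_, hw⟩).2.2.2.1]
    ring
  have := sub_eq_zero.mp (eq_zero_of_planeCross_eq_zero hkd h1 h2)
  exact hfF _ (this ▸ hvF)

end EmbeddedPolygon

/-! ### The billiard map is a bijection of the phase space -/

namespace TaggedPair

lemma swap_swap (p : TaggedPair) : p.swap.swap = p := by
  ext1 <;> simp [swap]

end TaggedPair

namespace PolygonPair

variable (P : PolygonPair)

/-- The move of the symplectic billiard on the polygon `P s` from `x` to `z`, while the other point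
is the interior point `y` of an edge. It is symmetric in `x` and `z`. -/
def IsMove (s : Bool) (x y z : Plane) : Prop :=
  ∃ j, y ∈ (P (!s)).edge j ∧ (P s).IsChord ((P (!s)).edgeVec j) x z

variable {P}

lemma IsMove.symm {s : Bool} {x y z : Plane} (h : P.IsMove s x y z) : P.IsMove s z y x := by
  obtain ⟨j, hj, hc⟩ := h
  exact ⟨j, hj, hc.symm⟩

lemma IsMove.unique {s : Bool} {x y z z' : Plane} (h : P.IsMove s x y z) (h' : P.IsMove s x y z')
    {i : Fin (P s).n} (hx : x ∈ (P s).edge i) : z = z' := by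
  obtain ⟨j, hj, hc⟩ := h
  obtain ⟨j', hj', hc'⟩ := h'
  obtain rfl := (P (!s)).edge_unique hj hj'
  exact hc.unique hc' ((P (!s)).edgeVec_ne_zero _) hx

lemma IsMove.planeCross_ne_zero {s : Bool} {x y z : Plane} (h : P.IsMove s x y z)
    {i : Fin (P s).n} (hx : x ∈ (P s).edge i) {j : Fin (P (!s)).n} (hy : y ∈ (P (!s)).edge j) :
    planeCross ((P s).edgeVec i) ((P (!s)).edgeVec j) ≠ 0 := by
  obtain ⟨j', hj, hc⟩ := h
  obtain rfl := (P (!s)).edge_unique hj hy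
  exact hc.planeCross_ne_zero ((P (!s)).edgeVec_ne_zero _) hx

variable (P)

lemma isNextPoint_iff {p : TaggedPair} (hp : p ∈ P.total) (z : Plane) :
    P.IsNextPoint p z ↔ P.IsMove p.side p.fst p.snd z := by
  constructor
  · rintro ⟨hz, hne, ⟨j, hj, hspan⟩, hin⟩
    exact ⟨j, hj, hp.1, hz, hne.symm,
      (planeCross_eq_zero_iff_mem_span (EmbeddedPolygon.edgeVec_ne_zero _ _)).mpr hspan, hin⟩
  · rintro ⟨j, hj, -, hz, hne, hspan, hin⟩
    exact ⟨hz, hne.symm, ⟨j, hj,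
      (planeCross_eq_zero_iff_mem_span (EmbeddedPolygon.edgeVec_ne_zero _ _)).mp hspan⟩, hin⟩

lemma exists_billiardMap_eq (p : P.maxPhaseSpace) :
    ∃ z, P.billiardMap p = ⟨!p.1.side, p.1.snd, z⟩ ∧ P.IsMove p.1.side p.1.fst p.1.snd z :=
  ⟨_, rfl, (P.isNextPoint_iff p.2.1 _).mp p.2.2.2.choose_spec.1⟩

lemma billiardMap_eq (p : P.maxPhaseSpace) {z : Plane}
    (h : P.IsMove p.1.side p.1.fst p.1.snd z) :
    P.billiardMap p = ⟨!p.1.side, p.1.snd, z⟩ := by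
  have := p.2.2.2.unique p.2.2.2.choose_spec.1 ((P.isNextPoint_iff p.2.1 z).mpr h)
  rw [billiardMap, this]

/-- A pair of interior points of two edges that are not parallel has a unique continuation. -/
lemma mem_maxPhaseSpace {p : TaggedPair} {i : Fin (P p.side).n} {j : Fin (P (!p.side)).n}
    (hi : p.fst ∈ (P p.side).edge i) (hj : p.snd ∈ (P (!p.side)).edge j)
    (hij : planeCross ((P p.side).edgeVec i) ((P (!p.side)).edgeVec j) ≠ 0) :
    p ∈ P.maxPhaseSpace := by
  have ht : p ∈ P.total :=
    ⟨EmbeddedPolygon.edge_subset_curve _ i hi, EmbeddedPolygon.edge_subset_curve _ j hj⟩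
  obtain ⟨z, hz⟩ := (P p.side).exists_isChord hi hij
  refine ⟨ht, EmbeddedPolygon.notMem_vertexSet_of_mem_edge _ hj, z,
    (P.isNextPoint_iff ht z).mpr ⟨j, hj, hz⟩, fun z' hz' => ?_⟩
  exact ((P.isNextPoint_iff ht z').mp hz').unique ⟨j, hj, hz⟩ hi

lemma exists_edges_of_mem_phaseSpace {p : TaggedPair} (hp : p ∈ P.phaseSpace) :
    ∃ (i : Fin (P p.side).n) (j : Fin (P (!p.side)).n),
      p.fst ∈ (P p.side).edge i ∧ p.snd ∈ (P (!p.side)).edge j := by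
  obtain ⟨j, hj⟩ := (P (!p.side)).exists_mem_edge hp.1.1.2 hp.1.2.1
  have hv : p.fst ∉ (P p.side).vertexSet := by
    intro hv
    refine hp.2 (Or.inr ⟨p.swap, mem_iUnion.mpr ⟨0, hp.1.1.2, ?_⟩, p.swap_swap⟩)
    simpa [TaggedPair.swap] using hv
  obtain ⟨i, hi⟩ := (P p.side).exists_mem_edge hp.1.1.1 hv
  exact ⟨i, j, hi, hj⟩

lemma planeCross_ne_zero_of_mem_phaseSpace {p : TaggedPair} (hp : p ∈ P.phaseSpace)
    {i : Fin (P p.side).n} {j : Fin (P (!p.side)).n}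
    (hi : p.fst ∈ (P p.side).edge i) (hj : p.snd ∈ (P (!p.side)).edge j) :
    planeCross ((P p.side).edgeVec i) ((P (!p.side)).edgeVec j) ≠ 0 := by
  obtain ⟨z, -, hz⟩ := P.exists_billiardMap_eq ⟨p, hp.1⟩
  exact hz.planeCross_ne_zero hi hj

lemma swap_mem_discontinuitySet {p : TaggedPair} (h : p.swap ∈ P.discontinuitySet) :
    p ∈ P.discontinuitySet := by
  rcases h with h | ⟨q, hq, h⟩
  · exact Or.inr ⟨_, h, p.swap_swap⟩
  · have := congrArg TaggedPair.swap h
    rw [TaggedPair.swap_swap, TaggedPair.swap_swap] at this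
    exact Or.inl (this ▸ hq)

lemma mem_maxPhaseSpace_swap {s : Bool} {x y : Plane} {i : Fin (P s).n} {j : Fin (P (!s)).n}
    (hi : x ∈ (P s).edge i) (hj : y ∈ (P (!s)).edge j)
    (hij : planeCross ((P s).edgeVec i) ((P (!s)).edgeVec j) ≠ 0) :
    (⟨!s, y, x⟩ : TaggedPair) ∈ P.maxPhaseSpace := by
  obtain ⟨t, rfl⟩ : ∃ t, s = !t := ⟨!s, by simp⟩
  obtain ⟨t', ht'⟩ : ∃ t', t' = !(!t) := ⟨_, rfl⟩
  revert j
  rw [← ht']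
  intro j hj hij
  obtain rfl : t' = t := by simpa using ht'
  exact P.mem_maxPhaseSpace (p := ⟨t', y, x⟩) hj hi
    (by rw [planeCross_swap]; exact neg_ne_zero.mpr hij)

lemma swap_mem_phaseSpace {p : TaggedPair} (hp : p ∈ P.phaseSpace) : p.swap ∈ P.phaseSpace := by
  obtain ⟨i, j, hi, hj⟩ := P.exists_edges_of_mem_phaseSpace hp
  refine ⟨P.mem_maxPhaseSpace_swap hi hj (P.planeCross_ne_zero_of_mem_phaseSpace hp hi hj),
    fun h => hp.2 (P.swap_mem_discontinuitySet h)⟩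

/-- The billiard map is reversible: the swap map conjugates it to its inverse. -/
lemma billiardMap_swap {s : Bool} {x y z : Plane} (h : P.IsMove s x y z)
    (hm : (⟨s, z, y⟩ : TaggedPair) ∈ P.maxPhaseSpace) :
    P.billiardMap ⟨⟨s, z, y⟩, hm⟩ = ⟨!s, y, x⟩ :=
  P.billiardMap_eq ⟨⟨s, z, y⟩, hm⟩ h.symm

lemma billiardMap_mem_phaseSpace {p : TaggedPair} (hp : p ∈ P.phaseSpace) :
    P.billiardMap ⟨p, hp.1⟩ ∈ P.phaseSpace := by
  obtain ⟨i, j, hi, hj⟩ := P.exists_edges_of_mem_phaseSpace hp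
  obtain ⟨z, hz, hmove⟩ := P.exists_billiardMap_eq ⟨p, hp.1⟩
  have hN : ∀ n, P.billiardMap ⟨p, hp.1⟩ ∉ P.discontinuityStep n := fun n hn =>
    hp.2 (Or.inl (mem_iUnion.mpr ⟨n + 1, ⟨⟨p, hp.1⟩, hn, rfl⟩⟩))
  rw [hz] at hN ⊢
  obtain ⟨s, x, y⟩ := p
  simp only at hi hj hmove hN ⊢
  have hzc : z ∈ (P s).curve := by
    obtain ⟨_, _, hc⟩ := hmove
    exact hc.2.1
  have hzv : z ∉ (P s).vertexSet := fun hv =>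
    hN 0 ⟨EmbeddedPolygon.edge_subset_curve _ _ hj, by simpa using hv⟩
  obtain ⟨k, hk⟩ := (P s).exists_mem_edge hzc hzv
  have hkj := hmove.symm.planeCross_ne_zero hk hj
  refine ⟨P.mem_maxPhaseSpace_swap hk hj hkj, ?_⟩
  rintro (h | ⟨q, hq, h⟩)
  · obtain ⟨n, hn⟩ := mem_iUnion.mp h
    exact hN n hn
  · obtain ⟨n, hn⟩ := mem_iUnion.mp hq
    have hq' : q = ⟨s, z, y⟩ := by
      have := congrArg TaggedPair.swap h
      rw [TaggedPair.swap_swap] at this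
      rw [this]
      simp [TaggedPair.swap]
    subst hq'
    cases n with
    | zero => exact EmbeddedPolygon.notMem_vertexSet_of_mem_edge _ hj hn.2
    | succ n =>
      obtain ⟨⟨q', hm⟩, hn', rfl⟩ := hn
      have hn' : P.billiardMap ⟨_, hm⟩ ∈ P.discontinuityStep n := hn'
      rw [P.billiardMap_swap hmove hm] at hn'
      exact hp.2 (Or.inr ⟨_, mem_iUnion.mpr ⟨n, hn'⟩, TaggedPair.swap_swap ⟨s, x, y⟩⟩)

/-- The billiard map as a map of the phase space to itself. -/
noncomputable def phaseMap (p : P.phaseSpace) : P.phaseSpace :=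
  ⟨P.billiardMap ⟨p.1, p.2.1⟩, P.billiardMap_mem_phaseSpace p.2⟩

/-- The swap map as a map of the phase space to itself. -/
def phaseSwap (p : P.phaseSpace) : P.phaseSpace := ⟨p.1.swap, P.swap_mem_phaseSpace p.2⟩

lemma phaseSwap_phaseSwap (p : P.phaseSpace) : P.phaseSwap (P.phaseSwap p) = p :=
  Subtype.ext p.1.swap_swap

lemma phaseMap_phaseSwap_phaseMap (p : P.phaseSpace) :
    P.phaseMap (P.phaseSwap (P.phaseMap p)) = P.phaseSwap p := by
  obtain ⟨z, hz, hmove⟩ := P.exists_billiardMap_eq ⟨p.1, p.2.1⟩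
  have h : (P.phaseSwap (P.phaseMap p)).1 = ⟨p.1.side, z, p.1.snd⟩ := by
    simp [phaseSwap, phaseMap, hz, TaggedPair.swap]
  obtain ⟨q, hq⟩ : ∃ q, q = P.phaseSwap (P.phaseMap p) := ⟨_, rfl⟩
  rw [← hq] at h ⊢
  obtain ⟨q, hq'⟩ := q
  simp only at h
  subst h
  exact Subtype.ext (P.billiardMap_swap hmove hq'.1)

/-- The billiard map as a bijection of the phase space. -/
noncomputable def phasePerm : Equiv.Perm P.phaseSpace where
  toFun := P.phaseMap
  invFun p := P.phaseSwap (P.phaseMap (P.phaseSwap p))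
  left_inv p := by
    change P.phaseSwap (P.phaseMap (P.phaseSwap (P.phaseMap p))) = p
    rw [P.phaseMap_phaseSwap_phaseMap, P.phaseSwap_phaseSwap]
  right_inv p := by rw [P.phaseMap_phaseSwap_phaseMap, P.phaseSwap_phaseSwap]

lemma isOrbit_iff (q : ℤ → P.phaseSpace) :
    P.IsOrbit q ↔ ∀ k, q k = (P.phasePerm ^ k) (q 0) := by
  have h1 : P.IsOrbit q ↔ ∀ k, P.phasePerm (q k) = q (k + 1) :=
    forall_congr' fun k => ⟨fun h => Subtype.ext h, fun h => congrArg Subtype.val h⟩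
  rw [h1]
  constructor
  · intro h k
    induction k with
    | zero => simp
    | succ k ih => rw [← h, ih, add_comm, zpow_one_add, Equiv.Perm.mul_apply]
    | pred k ih =>
      apply P.phasePerm.injective
      rw [h, sub_add_cancel, ih, ← Equiv.Perm.mul_apply, ← zpow_one_add]
      congr 2; ring
  · intro h k
    rw [h k, h (k + 1), add_comm, zpow_one_add, Equiv.Perm.mul_apply]

lemma existsUnique_orbit (p : P.phaseSpace) :
    ∃! q : ℤ → P.phaseSpace, P.IsOrbit q ∧ q 0 = p := by
  refine ⟨fun k => (P.phasePerm ^ k) p, ⟨(P.isOrbit_iff _).mpr fun k => by simp, by simp⟩, ?_⟩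
  rintro q ⟨hq, rfl⟩
  funext k
  exact (P.isOrbit_iff q).mp hq k

end PolygonPair

/-! ### Bounded sequences with geometric increments -/

lemma abs_le_one_of_geometric_of_bounded {u : ℕ → ℝ} {c B : ℝ} (hu : ∀ m, u (m + 1) = c * u m)
    (h0 : u 0 ≠ 0) (hB : ∀ m, |u m| ≤ B) : |c| ≤ 1 := by
  by_contra! hc
  obtain ⟨m, hm⟩ := pow_unbounded_of_one_lt (B / |u 0|) hc
  have hum : ∀ m, u m = c ^ m * u 0 := by
    intro m
    induction m with
    | zero => simp
    | succ m ih => rw [hu, ih]; ring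
  have h := hB m
  rw [hum, abs_mul, abs_pow] at h
  rw [div_lt_iff₀ (abs_pos.mpr h0)] at hm
  linarith

/-- If a bounded two-sided sequence has increments in geometric progression, then these increments
vanish or alternate in sign, so the sequence has period two. -/
lemma increments_cancel_of_bounded {u t : ℤ → ℝ} {c B : ℝ} (hc : c ≠ 0)
    (hu : ∀ m, u (m + 1) = c * u m) (ht : ∀ m, t (m + 1) = t m + u m) (hB : ∀ m, |t m| ≤ B) :
    u 0 + u 1 = 0 := by
  have hu1 : u 1 = c * u 0 := by simpa using hu 0
  by_cases h0 : u 0 = 0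
  · rw [hu1, h0]; ring
  have huB : ∀ m, |u m| ≤ 2 * B := by
    intro m
    have : u m = t (m + 1) - t m := by rw [ht]; ring
    rw [this]
    have := abs_sub (t (m + 1)) (t m)
    linarith [hB m, hB (m + 1)]
  have h1 : |c| ≤ 1 := abs_le_one_of_geometric_of_bounded (u := fun m : ℕ => u m)
    (fun m => by push_cast; exact hu m) (by simpa using h0) fun m => huB m
  have h2 : |c⁻¹| ≤ 1 := by
    refine abs_le_one_of_geometric_of_bounded (u := fun m : ℕ => u (-m)) (fun m => ?_)
      (by simpa using h0) fun m => huB _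
    have h := hu (-(m + 1))
    rw [neg_add, neg_add_cancel_right] at h
    push_cast
    rw [neg_add, h, inv_mul_cancel_left₀ hc]
  have hc1 : |c| = 1 := by
    refine le_antisymm h1 ?_
    rw [abs_inv] at h2
    by_contra! h'
    exact absurd ((one_lt_inv₀ (abs_pos.mpr hc)).mpr h') (not_lt.mpr h2)
  rcases eq_or_eq_neg_of_abs_eq hc1 with rfl | rfl
  · -- a translation by a nonzero amount has no bounded orbit
    exfalso
    have hum : ∀ m : ℕ, t m = t 0 + m * u 0 ∧ u m = u 0 := by
      intro m
      induction m with
      | zero => simp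
      | succ m ih =>
        push_cast
        rw [ht, hu, ih.1, ih.2]
        constructor <;> ring
    obtain ⟨m, hm⟩ := exists_nat_gt (2 * B / |u 0|)
    rw [div_lt_iff₀ (abs_pos.mpr h0)] at hm
    have : (m : ℝ) * u 0 = t m - t 0 := by rw [(hum m).1]; ring
    have h3 := abs_sub (t m) (t 0)
    rw [← this, abs_mul, Nat.abs_cast] at h3
    linarith [hB m, hB 0]
  · rw [hu1]; ring

/-- Let `X` be a bounded sequence of points, each on a line with direction `E k`, such that the
move from `X k` to `X (k + 2)` is parallel to `E (k + 1)`. If the directions have period `2 h` and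
`X (k + 2 h)` lies on the line of `X k`, then `X` has period `4 h`: advancing time by `2 h` is an
affine map of each line with a bounded orbit, that is, the identity or a reflection on this
orbit. -/
lemma periodic_of_parallel_moves {X E : ℤ → Plane} {B : ℝ} (hB : ∀ k, ‖X k‖ ≤ B) (h : ℕ)
    (hE : Function.Periodic E (2 * h : ℤ))
    (hEE : ∀ k, planeCross (E k) (E (k + 1)) ≠ 0)
    (hmove : ∀ k, planeCross (E (k + 1)) (X (k + 2) - X k) = 0)
    (hshift : ∀ k, planeCross (E k) (X (k + 2 * h) - X k) = 0) (k : ℤ) :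
    X (k + 2 * (2 * h)) = X k := by
  have hE0 : ∀ k, E k ≠ 0 := by
    intro k h0
    exact hEE k (by rw [h0]; simp [planeCross])
  choose δ hδ using fun k => (planeCross_eq_zero_iff (hE0 k)).mp (hshift k)
  have hEm : ∀ k m : ℤ, E (k + m * (2 * h)) = E k := fun k m => hE.int_mul m k
  -- the displacements at times of equal parity are related by projection
  have hstep : ∀ k, δ (k + 2) * planeCross (E (k + 1)) (E (k + 2)) =
      δ k * planeCross (E (k + 1)) (E k) := by
    intro k
    have h1 := hmove k
    have h2 := hmove (k + 2 * h)
    have h3 : E (k + 2 * h + 1) = E (k + 1) := by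
      rw [add_right_comm]; exact hE (k + 1)
    rw [h3] at h2
    have h4 : δ (k + 2) • E (k + 2) = δ k • E k + (X (k + 2 * h + 2) - X (k + 2 * h)) -
        (X (k + 2) - X k) := by
      rw [← hδ, ← hδ, add_right_comm k 2 (2 * (h : ℤ))]; abel
    have h5 := congrArg (planeCross (E (k + 1))) h4
    rwa [planeCross_sub_right, planeCross_add_right, h1, h2, planeCross_smul_right,
      planeCross_smul_right, add_zero, sub_zero] at h5
  have hratio : ∀ j : ℕ, ∃ c : ℝ, c ≠ 0 ∧ ∀ m : ℤ,
      δ (k + m * (2 * h) + 2 * j) = c * δ (k + m * (2 * h)) := by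
    intro j
    induction j with
    | zero => exact ⟨1, one_ne_zero, fun m => by simp⟩
    | succ j ih =>
      obtain ⟨c, hc, hcm⟩ := ih
      set l : ℤ := k + 2 * j with hl
      have hn1 : planeCross (E (l + 1)) (E (l + 2)) ≠ 0 := by
        have := hEE (l + 1)
        rwa [show l + 1 + 1 = l + 2 by ring] at this
      have hn2 : planeCross (E (l + 1)) (E l) ≠ 0 := by
        rw [planeCross_swap]; exact neg_ne_zero.mpr (hEE l)
      refine ⟨c * (planeCross (E (l + 1)) (E l) / planeCross (E (l + 1)) (E (l + 2))),
        mul_ne_zero hc (div_ne_zero hn2 hn1), fun m => ?_⟩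
      have h1 := hstep (k + m * (2 * h) + 2 * j)
      have e0 : k + m * (2 * h) + 2 * (j : ℤ) = l + m * (2 * h) := by rw [hl]; ring
      have e1 : k + m * (2 * h) + 2 * (j : ℤ) + 1 = (l + 1) + m * (2 * h) := by rw [hl]; ring
      have e2 : k + m * (2 * h) + 2 * (j : ℤ) + 2 = (l + 2) + m * (2 * h) := by rw [hl]; ring
      have e3 : k + m * (2 * h) + 2 * ((j + 1 : ℕ) : ℤ) = k + m * (2 * h) + 2 * (j : ℤ) + 2 := by
        push_cast; ring
      rw [hcm m, e1, hEm] at h1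
      rw [e3]
      rw [show E (k + m * (2 * h) + 2 * (j : ℤ) + 2) = E (l + 2) by rw [e2, hEm],
        show E (k + m * (2 * h) + 2 * (j : ℤ)) = E l by rw [e0, hEm]] at h1
      field_simp
      linarith
  obtain ⟨c, hc, hcm⟩ := hratio h
  -- a vector that detects displacements along the direction at time `k`
  set M := E (k + 1) with hM
  have hMk : planeCross M (E k) ≠ 0 := by
    rw [planeCross_swap]; exact neg_ne_zero.mpr (hEE k)
  have hadd : ∀ m : ℤ, k + (m + 1) * (2 * h) = k + m * (2 * h) + 2 * h := fun m => by ring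
  have hX : ∀ m : ℤ, X (k + (m + 1) * (2 * h)) =
      X (k + m * (2 * h)) + δ (k + m * (2 * h)) • E k := by
    intro m
    rw [← hEm k m, ← hδ, hadd]; abel
  have hcancel := increments_cancel_of_bounded (c := c) (B := (|M 0| + |M 1|) * B)
    (u := fun m => δ (k + m * (2 * h)) * planeCross M (E k))
    (t := fun m => planeCross M (X (k + m * (2 * h)))) hc
    (fun m => by rw [hadd, hcm]; ring)
    (fun m => by rw [hX, planeCross_add_right, planeCross_smul_right])
    (fun m => by
      simp only [planeCross]
      have b0 : |X (k + m * (2 * h)) 0| ≤ B := (PiLp.norm_apply_le _ 0).trans (hB _)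
      have b1 : |X (k + m * (2 * h)) 1| ≤ B := (PiLp.norm_apply_le _ 1).trans (hB _)
      refine (abs_sub _ _).trans ?_
      rw [abs_mul, abs_mul]
      nlinarith [abs_nonneg (M 0), abs_nonneg (M 1)])
  have hsum : δ (k + 0 * (2 * h)) + δ (k + 1 * (2 * h)) = 0 := by
    rw [← add_mul] at hcancel
    exact (mul_eq_zero.mp hcancel).resolve_right hMk
  have h1 := hX 0
  have h2 := hX 1
  rw [zero_add] at h1
  rw [h1, add_assoc (X _), ← add_smul, hsum, zero_smul] at h2
  have e : k + (1 + 1) * (2 * (h : ℤ)) = k + 2 * (2 * h) := by ring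
  rw [e] at h2
  simpa using h2

/-! ### Cells of the edges without filled vertices -/

namespace EmbeddedPolygon

variable (Q : EmbeddedPolygon)

open Classical in
/-- The vector of the edge that contains the point `x` in its interior, and `0` if there is none. -/
noncomputable def edgeDir (x : Plane) : Plane :=
  if h : ∃ i, x ∈ Q.edge i then Q.edgeVec h.choose else 0

lemma edgeDir_eq {i : Fin Q.n} {x : Plane} (hx : x ∈ Q.edge i) : Q.edgeDir x = Q.edgeVec i := by
  have h : ∃ i, x ∈ Q.edge i := ⟨i, hx⟩
  rw [edgeDir, dif_pos h, Q.edge_unique h.choose_spec hx]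

/-- A parametrization of the curve by half-open edges is injective. -/
lemma edge_param_injective {i j : Fin Q.n} {r s : ℝ} (hr0 : 0 ≤ r) (hr1 : r < 1) (hs0 : 0 ≤ s)
    (hs1 : s < 1) (h : Q.poly i + r • Q.edgeVec i = Q.poly j + s • Q.edgeVec j) :
    i = j ∧ r = s := by
  have hij : i = j := by
    rcases hr0.eq_or_lt with rfl | hr0
    · rcases hs0.eq_or_lt with rfl | hs0
      · exact Q.injective_vertices (by simpa using h)
      · rw [zero_smul, add_zero] at h
        exact absurd (Q.mem_edge_iff.mpr ⟨s, hs0, hs1, h⟩) (Q.vertex_notMem_edge i j)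
    · have hi : Q.poly i + r • Q.edgeVec i ∈ Q.edge i := Q.mem_edge_iff.mpr ⟨r, hr0, hr1, rfl⟩
      rcases hs0.eq_or_lt with rfl | hs0
      · rw [h, zero_smul, add_zero] at hi
        exact absurd hi (Q.vertex_notMem_edge j i)
      · exact Q.edge_unique hi (Q.mem_edge_iff.mpr ⟨s, hs0, hs1, h⟩)
  subst hij
  exact ⟨rfl, smul_left_injective ℝ (Q.edgeVec_ne_zero i) (add_left_cancel h)⟩

/-- `x` and `x'` belong to the same cell of the curve with respect to `F`: they are interior points
of one edge, and they coincide or the closed segment between them avoids `F`. A point of `F` is thus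
a cell of its own. -/
def SameCell (F : Set Plane) (x x' : Plane) : Prop :=
  ∃ i, x ∈ Q.edge i ∧ x' ∈ Q.edge i ∧ (x = x' ∨ Disjoint (segment ℝ x x') F)

/-- The point `a` of `F` marks the cell of `x`: it is `x` itself if `x` belongs to `F`, and
otherwise the last point of `F` before `x` on the edge of `x`. -/
def IsMark (F : Set Plane) (x a : Plane) : Prop :=
  a ∈ F ∧ (x ∈ F → a = x) ∧ (x ∉ F → ∃ (i : Fin Q.n) (r t : ℝ), 0 ≤ r ∧ r < t ∧ t < 1 ∧
    a = Q.poly i + r • Q.edgeVec i ∧ x = Q.poly i + t • Q.edgeVec i ∧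
    ∀ u, r < u → u ≤ t → Q.poly i + u • Q.edgeVec i ∉ F)

lemma exists_isMark {F : Set Plane} (hF : F.Finite) (hVF : Q.vertexSet ⊆ F) {i : Fin Q.n}
    {x : Plane} (hx : x ∈ Q.edge i) : ∃ a, Q.IsMark F x a := by
  by_cases hxF : x ∈ F
  · exact ⟨x, hxF, fun _ => rfl, fun h => absurd hxF h⟩
  obtain ⟨t, ht0, ht1, hxt⟩ := Q.mem_edge_iff.mp hx
  set g : ℝ → Plane := fun u => Q.poly i + u • Q.edgeVec i with hg
  have hginj : Function.Injective g := fun u v h =>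
    smul_left_injective ℝ (Q.edgeVec_ne_zero i) (add_left_cancel h)
  set R : Set ℝ := {u | 0 ≤ u ∧ u ≤ t ∧ g u ∈ F} with hR
  have hRfin : R.Finite := (hF.preimage hginj.injOn).subset fun u hu => hu.2.2
  have hRne : R.Nonempty := ⟨0, le_rfl, ht0.le, hVF ⟨i, by simp [hg]⟩⟩
  obtain ⟨r, hr, hmax⟩ := hRfin.exists_maximal hRne
  have hrt : r < t := lt_of_le_of_ne hr.2.1 fun h => hxF (by rw [hxt, ← h]; exact hr.2.2)
  refine ⟨g r, hr.2.2, fun h => absurd h hxF, fun _ => ⟨i, r, t, hr.1, hrt, ht1, rfl, hxt, ?_⟩⟩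
  intro u hru hut huF
  exact (hmax ⟨hr.1.trans hru.le, hut, huF⟩ hru.le).not_gt hru

/-- Points with the same mark lie in the same cell, if both or none of them belong to `F`. -/
lemma sameCell_of_isMark {F : Set Plane} {x x' a : Plane} (h : Q.IsMark F x a)
    (h' : Q.IsMark F x' a) (hiff : x ∈ F ↔ x' ∈ F) {i : Fin Q.n} (hx : x ∈ Q.edge i) :
    Q.SameCell F x x' := by
  by_cases hxF : x ∈ F
  · obtain rfl : x = x' := (h.2.1 hxF).symm.trans (h'.2.1 (hiff.mp hxF))
    exact ⟨i, hx, hx, Or.inl rfl⟩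
  obtain ⟨i, r, t, hr0, hrt, ht1, ha, hxt, hu⟩ := h.2.2 hxF
  obtain ⟨j, s, t', hs0, hst, ht1', ha', hxt', hu'⟩ := h'.2.2 (fun h => hxF (hiff.mpr h))
  obtain ⟨rfl, rfl⟩ := Q.edge_param_injective hr0 (hrt.trans ht1) hs0 (hst.trans ht1')
    (ha.symm.trans ha')
  refine ⟨i, Q.mem_edge_iff.mpr ⟨t, hr0.trans_lt hrt, ht1, hxt⟩,
    Q.mem_edge_iff.mpr ⟨t', hr0.trans_lt hst, ht1', hxt'⟩, Or.inr ?_⟩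
  rw [Set.disjoint_left]
  intro v hv
  obtain ⟨c, hc0, hc1, hvc⟩ := mem_segment_iff_smul.mp hv
  have hv' : v = Q.poly i + (t + c * (t' - t)) • Q.edgeVec i := by
    rw [hvc, hxt, hxt']; module
  have hr : r < t + c * (t' - t) := by
    rcases hc0.eq_or_lt with rfl | hc0
    · linarith
    · nlinarith
  rw [hv']
  rcases le_total t t' with h | h
  · exact hu' _ hr (by nlinarith)
  · exact hu _ hr (by nlinarith)

variable {Q}

lemma SameCell.edgeDir_eq {F : Set Plane} {x x' : Plane} (h : Q.SameCell F x x') :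
    Q.edgeDir x = Q.edgeDir x' := by
  obtain ⟨i, hx, hx', -⟩ := h
  rw [Q.edgeDir_eq hx, Q.edgeDir_eq hx']

lemma SameCell.planeCross_edgeDir {F : Set Plane} {x x' : Plane} (h : Q.SameCell F x x') :
    planeCross (Q.edgeDir x) (x' - x) = 0 := by
  obtain ⟨i, hx, hx', -⟩ := h
  rw [Q.edgeDir_eq hx, Q.planeCross_sub_of_mem_edge hx' hx]

end EmbeddedPolygon

/-! ### Orbits visit finitely many pairs of cells -/

namespace PolygonPair

variable {P : PolygonPair}

lemma vertexSet_subset_filledPart (s : Bool) : (P s).vertexSet ⊆ P.filledPart s :=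
  fun _ hx => mem_iUnion.mpr ⟨0, hx⟩

lemma mem_filledPart_of_isChord {s : Bool} {j : Fin (P (!s)).n} {v w : Plane}
    (h : (P s).IsChord ((P (!s)).edgeVec j) v w) (hw : w ∈ P.filledPart s) :
    v ∈ P.filledPart s := by
  obtain ⟨i, hi⟩ := mem_iUnion.mp hw
  exact mem_iUnion.mpr ⟨i + 1, h.1, w, hi, h.2.2.2.2, j,
    (planeCross_eq_zero_iff_mem_span ((P (!s)).edgeVec_ne_zero j)).mp h.2.2.2.1⟩

lemma IsMove.mem_filledPart_iff {s : Bool} {x y z : Plane} (h : P.IsMove s x y z) :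
    x ∈ P.filledPart s ↔ z ∈ P.filledPart s := by
  obtain ⟨j, -, hc⟩ := h
  exact ⟨fun hx => mem_filledPart_of_isChord hc.symm hx, fun hz => mem_filledPart_of_isChord hc hz⟩

/-- The cells of the two points determine the cell after the move. -/
lemma IsMove.sameCell {s : Bool} {x x' y y' z z' : Plane} (h : P.IsMove s x y z)
    (h' : P.IsMove s x' y' z') (hx : (P s).SameCell (P.filledPart s) x x')
    (hy : (P (!s)).SameCell (P.filledPart (!s)) y y') {k : Fin (P s).n} (hz : z ∈ (P s).edge k) :
    (P s).SameCell (P.filledPart s) z z' := by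
  obtain ⟨j, hj, hc⟩ := h
  obtain ⟨j', hj', hc'⟩ := h'
  obtain ⟨l, hl, hl', -⟩ := hy
  obtain rfl := (P (!s)).edge_unique hj hl
  obtain rfl := (P (!s)).edge_unique hj' hl'
  obtain ⟨i, hi, hi', rfl | hdisj⟩ := hx
  · obtain rfl := hc.unique hc' ((P (!s)).edgeVec_ne_zero _) hi
    exact ⟨k, hz, hz, Or.inl rfl⟩
  · obtain ⟨k, hk, hk', hd⟩ := (P s).exists_edge_of_isChord (vertexSet_subset_filledPart s)
      ((P (!s)).edgeVec_ne_zero _) (fun v w => mem_filledPart_of_isChord) hi hi' hdisj hc hc'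
    exact ⟨k, hk, hk', Or.inr hd⟩

lemma finite_filledPart (hF : P.filledSet.Finite) (s : Bool) : (P.filledPart s).Finite :=
  hF.preimage (f := fun x => (s, x)) fun _ _ _ _ h => (Prod.mk.inj h).2

/-- The polygons `P (s k)` and points `X k` of an orbit; consecutive points `X k`, `X (k + 1)` form
the `k`-th pair. -/
structure IsTrajectory (P : PolygonPair) (s : ℤ → Bool) (X : ℤ → Plane) : Prop where
  side : ∀ k, s (k + 1) = !s k
  edge : ∀ k, ∃ i, X k ∈ (P (s k)).edge i
  move : ∀ k, P.IsMove (s k) (X k) (X (k + 1)) (X (k + 2))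

lemma IsOrbit.side_eq {q : ℤ → P.phaseSpace} (hq : P.IsOrbit q) (k : ℤ) :
    (q (k + 1)).1.side = !(q k).1.side := by
  rw [← hq k]; rfl

lemma IsOrbit.fst_eq {q : ℤ → P.phaseSpace} (hq : P.IsOrbit q) (k : ℤ) :
    (q (k + 1)).1.fst = (q k).1.snd := by
  rw [← hq k]; rfl

lemma IsOrbit.isTrajectory {q : ℤ → P.phaseSpace} (hq : P.IsOrbit q) :
    P.IsTrajectory (fun k => (q k).1.side) (fun k => (q k).1.fst) where
  side := hq.side_eq
  edge k := by
    obtain ⟨i, -, hi, -⟩ := P.exists_edges_of_mem_phaseSpace (q k).2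
    exact ⟨i, hi⟩
  move k := by
    obtain ⟨z, hz, hmove⟩ := P.exists_billiardMap_eq ⟨(q k).1, (q k).2.1⟩
    have h2 : (q (k + 2)).1.fst = z := by
      rw [show k + 2 = k + 1 + 1 by ring, hq.fst_eq, ← hq k, hz]
    rw [h2, hq.fst_eq]
    exact hmove

namespace IsTrajectory

variable {s : ℤ → Bool} {X : ℤ → Plane}

lemma side_add_two (hX : P.IsTrajectory s X) (k : ℤ) : s (k + 2) = s k := by
  rw [show k + 2 = k + 1 + 1 by ring, hX.side, hX.side, Bool.not_not]

lemma side_periodic (hX : P.IsTrajectory s X) (h : ℤ) : Function.Periodic s (2 * h) := by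
  have : Function.Periodic s 2 := hX.side_add_two
  rw [mul_comm]
  exact this.int_mul h

lemma mem_filledPart_iff (hX : P.IsTrajectory s X) (k m : ℤ) :
    X (k + 2 * m) ∈ P.filledPart (s (k + 2 * m)) ↔ X k ∈ P.filledPart (s k) := by
  have h2 : ∀ k, X (k + 2) ∈ P.filledPart (s (k + 2)) ↔ X k ∈ P.filledPart (s k) := fun k => by
    rw [hX.side_add_two]; exact (hX.move k).mem_filledPart_iff.symm
  induction m with
  | zero => simp
  | succ m ih => rw [mul_add, mul_one, ← add_assoc]; exact (h2 _).trans ih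
  | pred m ih =>
    refine (h2 _).symm.trans ?_
    rw [show k + 2 * (-(m : ℤ) - 1) + 2 = k + 2 * -(m : ℤ) by ring]
    exact ih

/-- If a pair of cells is visited twice, `2 h` steps apart, then the sequence of cells has
period `2 h`. -/
lemma sameCell_of_sameCell (hX : P.IsTrajectory s X) {h a : ℤ}
    (h0 : (P (s a)).SameCell (P.filledPart (s a)) (X a) (X (a + 2 * h)))
    (h1 : (P (s (a + 1))).SameCell (P.filledPart (s (a + 1))) (X (a + 1)) (X (a + 1 + 2 * h)))
    (k : ℤ) : (P (s k)).SameCell (P.filledPart (s k)) (X k) (X (k + 2 * h)) := by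
  set C : ℤ → Prop := fun k => (P (s k)).SameCell (P.filledPart (s k)) (X k) (X (k + 2 * h))
    with hC
  have hmove : ∀ k, P.IsMove (s k) (X (k + 2 * h)) (X (k + 1 + 2 * h)) (X (k + 2 + 2 * h)) := by
    intro k
    have := hX.move (k + 2 * h)
    rwa [hX.side_periodic h k, add_right_comm k _ 1, add_right_comm k _ 2] at this
  have hfwd : ∀ k, C k → C (k + 1) → C (k + 2) := by
    intro k h0 h1
    simp only [hC] at h0 h1 ⊢
    obtain ⟨i, hi⟩ := hX.edge (k + 2)
    rw [hX.side] at h1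
    revert i
    rw [hX.side_add_two]
    intro i hi
    exact (hX.move k).sameCell (hmove k) h0 h1 hi
  have hbwd : ∀ k, C (k + 1) → C (k + 2) → C k := by
    intro k h1 h2
    simp only [hC] at h1 h2 ⊢
    obtain ⟨i, hi⟩ := hX.edge k
    rw [hX.side] at h1
    rw [hX.side_add_two] at h2
    exact (hX.move k).symm.sameCell (hmove k).symm h2 h1 hi
  have hboth : ∀ m : ℤ, C (a + m) ∧ C (a + m + 1) := by
    intro m
    induction m with
    | zero => rw [add_zero]; exact ⟨h0, h1⟩
    | succ m ih =>
      rw [← add_assoc]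
      exact ⟨ih.2, by
        have := hfwd _ ih.1 ih.2
        rwa [show a + (m : ℤ) + 1 + 1 = a + m + 2 by ring]⟩
    | pred m ih =>
      have e1 : a + (-(m : ℤ) - 1) + 1 = a + -(m : ℤ) := by ring
      have e2 : a + (-(m : ℤ) - 1) + 2 = a + -(m : ℤ) + 1 := by ring
      rw [e1]
      exact ⟨hbwd _ (by rw [e1]; exact ih.1) (by rw [e2]; exact ih.2), ih.1⟩
  have := (hboth (k - a)).1
  rwa [add_sub_cancel] at this

lemma exists_norm_le (hX : P.IsTrajectory s X) : ∃ B, ∀ k, ‖X k‖ ≤ B := by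
  have hb : Bornology.IsBounded (⋃ t, (P t).curve) :=
    (Bornology.isBounded_iUnion).mpr fun t => (P t).isCompact_curve.isBounded
  obtain ⟨B, hB⟩ := hb.exists_norm_le
  refine ⟨B, fun k => hB _ (mem_iUnion.mpr ⟨s k, ?_⟩)⟩
  obtain ⟨i, hi⟩ := hX.edge k
  exact EmbeddedPolygon.edge_subset_curve _ i hi

/-- If the sequence of cells has period `2 h`, then the sequence of points has period `4 h`. -/
lemma eq_of_sameCell (hX : P.IsTrajectory s X) {h : ℕ}
    (hC : ∀ k : ℤ, (P (s k)).SameCell (P.filledPart (s k)) (X k) (X (k + 2 * h))) (k : ℤ) :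
    X (k + 2 * (2 * h)) = X k := by
  obtain ⟨B, hB⟩ := hX.exists_norm_le
  refine periodic_of_parallel_moves (E := fun k => (P (s k)).edgeDir (X k)) hB h ?_ ?_ ?_ ?_ k
  · intro k
    beta_reduce
    rw [hX.side_periodic h k, (hC k).edgeDir_eq]
  · intro k
    obtain ⟨i, hi⟩ := hX.edge k
    have h1 := hX.edge (k + 1)
    rw [hX.side] at h1 ⊢
    obtain ⟨j, hj⟩ := h1
    rw [EmbeddedPolygon.edgeDir_eq _ hi, EmbeddedPolygon.edgeDir_eq _ hj]
    exact (hX.move k).planeCross_ne_zero hi hj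
  · intro k
    obtain ⟨j, hj, hc⟩ := hX.move k
    rw [hX.side, EmbeddedPolygon.edgeDir_eq _ hj]
    exact hc.2.2.2.1
  · exact fun k => (hC k).planeCross_edgeDir

/-- By the pigeonhole principle, some pair of cells is visited twice within `2 |F₋| |F₊|` steps. -/
lemma exists_sameCell (hX : P.IsTrajectory s X) (hF : P.filledSet.Finite) :
    ∃ h : ℕ, 0 < h ∧ h ≤ (P.filledPart false).ncard * (P.filledPart true).ncard ∧
      ∀ k : ℤ, (P (s k)).SameCell (P.filledPart (s k)) (X k) (X (k + 2 * h)) := by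
  have hfin := finite_filledPart hF
  choose i hi using hX.edge
  choose a ha using fun k => (P (s k)).exists_isMark (hfin (s k))
    (vertexSet_subset_filledPart (s k)) (hi k)
  set N := (P.filledPart false).ncard * (P.filledPart true).ncard with hN
  have hs : ∀ m : ℕ, s (2 * m) = s 0 := fun m => by
    have := hX.side_periodic m 0
    rwa [zero_add] at this
  set T := (hfin (s 0)).toFinset ×ˢ (hfin (!s 0)).toFinset with hT
  have hcard : T.card = N := by
    rw [hT, Finset.card_product, ← Set.ncard_eq_toFinset_card _ (hfin _),
      ← Set.ncard_eq_toFinset_card _ (hfin _)]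
    cases s 0
    · rfl
    · exact mul_comm _ _
  have hmaps : ∀ m ∈ Finset.range (N + 1), (a (2 * (m : ℤ)), a (2 * (m : ℤ) + 1)) ∈ T := by
    intro m _
    have h0 := (ha (2 * m)).1
    have h1 := (ha (2 * m + 1)).1
    rw [hX.side, hs] at h1
    rw [hs] at h0
    simp only [hT, Finset.mem_product, Set.Finite.mem_toFinset]
    exact ⟨h0, h1⟩
  obtain ⟨m, hm, m', hm', hne, heq⟩ := Finset.exists_ne_map_eq_of_card_lt_of_maps_to
    (by rw [hcard, Finset.card_range]; exact Nat.lt_succ_self N) hmaps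
  have key : ∀ m m' : ℕ, m < m' → m' ≤ N → (a (2 * (m : ℤ)), a (2 * (m : ℤ) + 1)) =
      (a (2 * (m' : ℤ)), a (2 * (m' : ℤ) + 1)) → ∃ h : ℕ, 0 < h ∧ h ≤ N ∧
      ∀ k : ℤ, (P (s k)).SameCell (P.filledPart (s k)) (X k) (X (k + 2 * h)) := by
    intro m m' hlt hle heq
    obtain ⟨heq0, heq1⟩ := Prod.mk.inj heq
    refine ⟨m' - m, by omega, by omega, ?_⟩
    have hcell : ∀ k : ℤ, a k = a (k + 2 * (m' - m : ℕ)) →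
        (P (s k)).SameCell (P.filledPart (s k)) (X k) (X (k + 2 * (m' - m : ℕ))) := by
      intro k hk
      have h2 := ha (k + 2 * (m' - m : ℕ))
      have h3 := hX.mem_filledPart_iff k (m' - m : ℕ)
      rw [← hk] at h2
      rw [hX.side_periodic _ k] at h2 h3
      exact (P (s k)).sameCell_of_isMark (ha k) h2 h3.symm (hi k)
    have e0 : (2 * m : ℤ) + 2 * (m' - m : ℕ) = 2 * m' := by
      rw [Nat.cast_sub hlt.le]; ring
    have e1 : (2 * m + 1 : ℤ) + 2 * (m' - m : ℕ) = 2 * m' + 1 := by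
      rw [Nat.cast_sub hlt.le]; ring
    exact hX.sameCell_of_sameCell (hcell _ (by rw [e0]; exact heq0))
      (hcell _ (by rw [e1]; exact heq1))
  rw [Finset.mem_range] at hm hm'
  rcases lt_or_gt_of_ne hne with h | h
  · exact key m m' h (by omega) heq
  · exact key m' m h (by omega) heq.symm

end IsTrajectory

end PolygonPair

/-- If the filled set of vertices is finite, then through every point of the phase space there is
exactly one symplectic billiard orbit, and it is periodic with period at most `4 |F₋| |F₊|`. -/
theorem theorem3p1 (P : PolygonPair) (hF : P.filledSet.Finite) :
    ∀ p : P.phaseSpace,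
      (∃! q : ℤ → P.phaseSpace, P.IsOrbit q ∧ q 0 = p) ∧
      ∀ q : ℤ → P.phaseSpace, P.IsOrbit q → q 0 = p →
        ∃ n : ℕ, 0 < n ∧ n ≤ 4 * (P.filledPart false).ncard * (P.filledPart true).ncard ∧
          Function.Periodic q (n : ℤ) := by
  refine fun p => ⟨P.existsUnique_orbit p, fun q hq _ => ?_⟩
  have hX := hq.isTrajectory
  obtain ⟨h, hpos, hle, hC⟩ := hX.exists_sameCell hF
  refine ⟨2 * (2 * h), by omega, by rw [mul_assoc 4]; omega, fun k => ?_⟩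
  push_cast
  have h1 := hX.eq_of_sameCell hC k
  have h2 := hX.eq_of_sameCell hC (k + 1)
  have h3 := hX.side_periodic (2 * h) k
  rw [add_right_comm, hq.fst_eq, hq.fst_eq] at h2
  exact Subtype.ext (TaggedPair.ext h3 h1 h2)
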